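/- **Definitions.** Graphs are finite, simple and non-empty. An instance of the *Partially Ordered Hamiltonian Path Problem* (POHPP) or of the *Partially Ordered Hamiltonian Cycle Problem* (POHCP) is a graph $G$ together with a partial order $\pi$ on $V(G)$. POHPP asks whether $G$ has an ordered Hamiltonian path $(v_1,\dots,v_n)$ such that $(v_i,v_j)\in\pi$ implies $i\le j$ for all $i,j$; POHCP asks whether there is such a path for which, in addition, $v_1$ and $v_n$ are adjacent. The *distance to path* of $G$ is the minimal number of vertices whose removal from $G$ leaves a path. A *non-trivial module* of $G$ is a set $M\subsetneq V(G)$ such that for all $u,v\in M$ every neighbor of $u$ outside of $M$ is also a neighbor of $v$. The *distance to linear forest modules* of $G$ is the minimal number of vertices whose removal from $G$ leaves a graph all of whose components are paths and non-trivial modules of $G$. An *fpt-reduction* from a parameterized problem $P$ to a parameterized problem $Q$ maps every instance $x$ of $P$, with parameter $k$, to an instance of $Q$ that has the same answer and whose parameter is at most $g(k)$; it is computed in time $f(k)\cdot|x|^{O(1)}$; here $f$ and $g$ are computable functions. $\mathsf{W}[1]$ is the class of all parameterized problems that, for some constant $d\ge 1$, have an fpt-reduction to the problem of deciding whether a propositional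 formula in conjunctive normal form with at most $d$ literals per clause has a satisfying assignment with exactly $k$ true variables, parameterized by $k$. A parameterized problem is *$\mathsf{W}[1]$-hard* if every problem in $\mathsf{W}[1]$ has an fpt-reduction to it. **Theorem 3.1.** POHPP and POHCP are $\mathsf{W}[1]$-hard when parameterized by distance to path, and they are also $\mathsf{W}[1]$-hard when parameterized by distance to linear forest modules. -/

import Mathlib

/-! ### Words and their encodings -/

namespace POH

/-- The number `m` in unary, closed by an end marker. -/
def encNat (m : ℕ) : List Bool := List.replicate m true ++ [false]

/-- A list of encoded items; every item is announced by `true`, and `false` closes the list. -/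
def encList {α : Type} (e : α → List Bool) : List α → List Bool
  | [] => [false]
  | a :: l => true :: (e a ++ encList e l)

open Classical in
/-- The `n × n` truth table of a binary relation on `Fin n`, row by row. -/
noncomputable def encRel {n : ℕ} (r : Fin n → Fin n → Prop) : List Bool :=
  (List.finRange n).flatMap fun i => (List.finRange n).map fun j => decide (r i j)

theorem encNat_append_inj : ∀ {m m' : ℕ} {s t : List Bool},
    encNat m ++ s = encNat m' ++ t → m = m' ∧ s = t
  | 0, 0, s, t, h => by simpa [encNat] using h
  | 0, m' + 1, s, t, h => by simp [encNat, List.replicate_succ] at h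
  | m + 1, 0, s, t, h => by simp [encNat, List.replicate_succ] at h
  | m + 1, m' + 1, s, t, h => by
    have h' : encNat m ++ s = encNat m' ++ t := by
      simpa [encNat, List.replicate_succ] using h
    obtain ⟨h1, h2⟩ := encNat_append_inj h'
    exact ⟨by rw [h1], h2⟩

theorem encList_append_inj {α : Type} {e : α → List Bool}
    (he : ∀ a b s t, e a ++ s = e b ++ t → a = b ∧ s = t) :
    ∀ {l l' : List α} {s t : List Bool},
      encList e l ++ s = encList e l' ++ t → l = l' ∧ s = t
  | [], [], s, t, h => by simpa [encList] using h
  | [], b :: l', s, t, h => by simp [encList] at h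
  | a :: l, [], s, t, h => by simp [encList] at h
  | a :: l, b :: l', s, t, h => by
    simp only [encList, List.cons_append, List.append_assoc, List.cons.injEq, true_and] at h
    obtain ⟨h1, h2⟩ := he _ _ _ _ h
    obtain ⟨h3, h4⟩ := encList_append_inj he h2
    exact ⟨by rw [h1, h3], h4⟩

theorem flatMap_inj_of_length {α β : Type} {f g : α → List β}
    (hl : ∀ a, (f a).length = (g a).length) :
    ∀ {l : List α}, l.flatMap f = l.flatMap g → ∀ a ∈ l, f a = g a
  | [], _, a, ha => by simp at ha
  | b :: l, h, a, ha => by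
    simp only [List.flatMap_cons] at h
    obtain ⟨h1, h2⟩ := List.append_inj h (hl b)
    rcases List.mem_cons.1 ha with rfl | ha
    · exact h1
    · exact flatMap_inj_of_length hl h2 a ha

theorem length_encRel {n : ℕ} (r : Fin n → Fin n → Prop) : (encRel r).length = n * n := by
  simp [encRel, List.length_flatMap]

theorem encRel_inj {n : ℕ} {r r' : Fin n → Fin n → Prop} (h : encRel r = encRel r') : r = r' := by
  funext i j
  have h1 := flatMap_inj_of_length (fun a => by simp) h i (List.mem_finRange i)
  have h2 := List.map_inj_left.1 h1 j (List.mem_finRange j)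
  simpa using h2

/-! ### The machine model

A pure list-processing pointer machine (a structured "while" language). Memory holds binary trees;
finitely many variables, the ones that occur in the program, point into it. One unit of
time follows a pointer, creates a single cell, or tests whether a pointer is nil. A run of `t`
steps creates at most `t` cells, so runs are simulated by Turing machines with polynomial overhead,
and conversely a Turing machine tape is a pair of lists. -/

/-- The data of the machine: binary trees without labels. -/
inductive PTree : Type
  | nil : PTree
  | cons : PTree → PTree → PTree

namespace PTree

def head : PTree → PTree
  | nil => nil
  | cons a _ => a

def tail : PTree → PTree
  | nil => nil
  | cons _ b => b

def ofBit : Bool → PTree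
  | false => nil
  | true => cons nil nil

/-- A word as a linked list of bits. -/
def ofWord : List Bool → PTree
  | [] => nil
  | b :: w => cons (ofBit b) (ofWord w)

end PTree

/-- Programs; the variables are numbered. -/
inductive Cmd : Type
  | skip : Cmd
  | setNil (x : ℕ) : Cmd
  | copy (x y : ℕ) : Cmd
  | cons (x y z : ℕ) : Cmd
  | head (x y : ℕ) : Cmd
  | tail (x y : ℕ) : Cmd
  | seq (c₁ c₂ : Cmd) : Cmd
  | ite (x : ℕ) (c₁ c₂ : Cmd) : Cmd
  | loop (x : ℕ) (c : Cmd) : Cmd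

/-- The contents of the variables. -/
abbrev Store : Type := ℕ → PTree

/-- `Runs c s t s'`: started in the store `s`, the program `c` halts after exactly `t` steps in the
store `s'`. Conditions read "the value of `x` is not nil". -/
inductive Runs : Cmd → Store → ℕ → Store → Prop
  | skip (s : Store) : Runs .skip s 1 s
  | setNil (x : ℕ) (s : Store) : Runs (.setNil x) s 1 (Function.update s x .nil)
  | copy (x y : ℕ) (s : Store) : Runs (.copy x y) s 1 (Function.update s x (s y))
  | cons (x y z : ℕ) (s : Store) :
      Runs (.cons x y z) s 1 (Function.update s x (.cons (s y) (s z)))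
  | head (x y : ℕ) (s : Store) : Runs (.head x y) s 1 (Function.update s x (s y).head)
  | tail (x y : ℕ) (s : Store) : Runs (.tail x y) s 1 (Function.update s x (s y).tail)
  | seq {c₁ c₂ : Cmd} {s s' s'' : Store} {t₁ t₂ : ℕ} :
      Runs c₁ s t₁ s' → Runs c₂ s' t₂ s'' → Runs (.seq c₁ c₂) s (t₁ + t₂) s''
  | iteTrue {x : ℕ} {c₁ c₂ : Cmd} {s s' : Store} {t : ℕ} :
      s x ≠ .nil → Runs c₁ s t s' → Runs (.ite x c₁ c₂) s (t + 1) s'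
  | iteFalse {x : ℕ} {c₁ c₂ : Cmd} {s s' : Store} {t : ℕ} :
      s x = .nil → Runs c₂ s t s' → Runs (.ite x c₁ c₂) s (t + 1) s'
  | loopDone {x : ℕ} {c : Cmd} {s : Store} :
      s x = .nil → Runs (.loop x c) s 1 s
  | loopStep {x : ℕ} {c : Cmd} {s s' s'' : Store} {t₁ t₂ : ℕ} :
      s x ≠ .nil → Runs c s t₁ s' → Runs (.loop x c) s' t₂ s'' →
        Runs (.loop x c) s (t₁ + t₂ + 1) s''

/-- The input word is in variable `0`, all other variables are nil. -/
def initStore (w : List Bool) : Store := Function.update (fun _ => PTree.nil) 0 (PTree.ofWord w)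

/-- On the input word `w` the program `c` halts within `T` steps, with output word `w'` in
variable `0`. -/
def OutputsWithin (c : Cmd) (w w' : List Bool) (T : ℕ) : Prop :=
  ∃ t s, t ≤ T ∧ Runs c (initStore w) t s ∧ s 0 = PTree.ofWord w'

/-! ### Parameterized problems, fpt-reductions, W[1] -/

/-- A parameterized decision problem: instances, faithfully encoded as binary words, the
yes-instances, and the parameter of each instance. (A parameterized language over `{0, 1}` is the
case where the instances are the words themselves.) -/
structure ParamProblem where
  Inst : Type
  enc : Inst → List Bool
  enc_injective : Function.Injective enc
  yes : Inst → Prop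
  param : Inst → ℕ

/-- Many-one fpt-reducibility: a map of instances that preserves the answer, is computed in time
`f(k) · |x|^O(1)` for a computable `f`, where `k` is the parameter of the instance `x`, and
whose values have parameter at most `g(k)` for a computable `g`. (`|x| + 1` in place of `|x|` only
matters for the empty word.) -/
def FPTReducible (P Q : ParamProblem) : Prop :=
  ∃ (R : P.Inst → Q.Inst) (c : Cmd) (f g : ℕ → ℕ) (e : ℕ),
    Computable f ∧ Computable g ∧
    (∀ x, P.yes x ↔ Q.yes (R x)) ∧
    (∀ x, Q.param (R x) ≤ g (P.param x)) ∧
    ∀ x, OutputsWithin c (P.enc x) (Q.enc (R x))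
      (f (P.param x) * ((P.enc x).length + 1) ^ e)

/-- Instances of weighted satisfiability of `d`-CNF formulas: a formula in conjunctive normal form
in the variables `Fin n`, each clause being a list of at most `d` literals (`(x, true)` is the
literal `x`, `(x, false)` its negation), and a number `k`. -/
structure CNFInst (d : ℕ) where
  n : ℕ
  clauses : List (List (Fin n × Bool))
  width : ∀ C ∈ clauses, C.length ≤ d
  k : ℕ

namespace CNFInst

/-- Some assignment that makes exactly `k` variables true satisfies the formula. -/
def Yes {d : ℕ} (φ : CNFInst d) : Prop :=
  ∃ S : Finset (Fin φ.n), S.card = φ.k ∧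
    ∀ C ∈ φ.clauses, ∃ l ∈ C, (l.1 ∈ S ↔ l.2 = true)

def encLit {n : ℕ} (l : Fin n × Bool) : List Bool := l.2 :: encNat l.1

def enc {d : ℕ} (φ : CNFInst d) : List Bool :=
  encNat φ.n ++ (encNat φ.k ++ encList (encList encLit) φ.clauses)

theorem enc_injective {d : ℕ} : Function.Injective (enc (d := d)) := by
  rintro ⟨n, cl, w, k⟩ ⟨n', cl', w', k'⟩ h
  obtain ⟨h1, h2⟩ := encNat_append_inj h
  obtain ⟨h3, h4⟩ := encNat_append_inj h2
  dsimp only at h1 h3 h4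
  subst h1 h3
  have hlit : ∀ (a b : Fin n × Bool) (s t : List Bool),
      encLit a ++ s = encLit b ++ t → a = b ∧ s = t := by
    rintro ⟨a, p⟩ ⟨b, q⟩ s t hab
    simp only [encLit, List.cons_append, List.cons.injEq] at hab
    obtain ⟨h5, h6⟩ := encNat_append_inj hab.2
    exact ⟨Prod.ext (Fin.ext h5) hab.1, h6⟩
  have h7 : encList (encList encLit) cl ++ [] = encList (encList encLit) cl' ++ [] := by
    simpa using h4
  obtain ⟨h8, -⟩ := encList_append_inj (fun _ _ _ _ hh => encList_append_inj hlit hh) h7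
  subst h8
  rfl

end CNFInst

/-- Weighted satisfiability of `d`-CNF formulas, parameterized by the weight `k`. -/
def weightedCNFSat (d : ℕ) : ParamProblem where
  Inst := CNFInst d
  enc := CNFInst.enc
  enc_injective := CNFInst.enc_injective
  yes := CNFInst.Yes
  param φ := φ.k

/-- The class W[1]: the problems that are fpt-reducible to weighted satisfiability of `d`-CNF
formulas for some constant `d ≥ 1`. -/
def InW1 (P : ParamProblem) : Prop := ∃ d, 1 ≤ d ∧ FPTReducible P (weightedCNFSat d)

/-- W[1]-hardness under fpt-reductions. -/
def W1Hard (P : ParamProblem) : Prop := ∀ Q : ParamProblem, InW1 Q → FPTReducible Q P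

/-! ### Distance parameters -/

section Graph

variable {V : Type}

/-- The graph is a path (with at least one vertex). -/
def IsPathGraph (H : SimpleGraph V) : Prop :=
  ∃ m : ℕ, Nonempty (H ≃g SimpleGraph.pathGraph (m + 1))

/-- All connected components are paths. -/
def IsLinearForest (H : SimpleGraph V) : Prop :=
  ∀ C : H.ConnectedComponent, IsPathGraph C.toSimpleGraph

/-- A non-trivial module: a strict subset of the vertex set whose members have the same neighbours
outside of it. -/
def IsNontrivialModule (G : SimpleGraph V) (M : Set V) : Prop :=
  M ⊂ Set.univ ∧ ∀ u ∈ M, ∀ v ∈ M, ∀ w ∉ M, G.Adj u w → G.Adj v w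

/-- The graph `G - W`. -/
abbrev deleteVerts (G : SimpleGraph V) (W : Finset V) : SimpleGraph ↥((W : Set V)ᶜ) :=
  G.induce ((W : Set V)ᶜ)

/-- Distance to path: the least number of vertices whose removal leaves a path. -/
noncomputable def distToPath (G : SimpleGraph V) : ℕ :=
  sInf {k | ∃ W : Finset V, W.card = k ∧ IsPathGraph (deleteVerts G W)}

/-- Distance to linear forest modules: the least number of vertices whose removal leaves a
linear forest all of whose components are non-trivial modules of `G`. -/
noncomputable def distToLinearForestModules (G : SimpleGraph V) : ℕ :=
  sInf {k | ∃ W : Finset V, W.card = k ∧ IsLinearForest (deleteVerts G W) ∧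
    ∀ C : (deleteVerts G W).ConnectedComponent,
      IsNontrivialModule G (Subtype.val '' C.supp)}

end Graph

/-! ### Hamiltonian paths and cycles with precedence constraints -/

/-- A non-empty finite graph with a partial order on its vertex set. -/
structure OrderedGraph where
  n : ℕ
  pos : 0 < n
  G : SimpleGraph (Fin n)
  prec : Fin n → Fin n → Prop
  isPartialOrder : IsPartialOrder (Fin n) prec

namespace OrderedGraph

noncomputable def enc (I : OrderedGraph) : List Bool :=
  encNat I.n ++ (encRel I.G.Adj ++ encRel I.prec)

theorem enc_injective : Function.Injective enc := by
  rintro ⟨n, p, G, r, hr⟩ ⟨n', p', G', r', hr'⟩ h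
  obtain ⟨h1, h2⟩ := encNat_append_inj h
  dsimp only at h1 h2
  subst h1
  obtain ⟨h3, h4⟩ := List.append_inj h2 (by rw [length_encRel, length_encRel])
  have h5 := SimpleGraph.ext (encRel_inj h3)
  have h6 := encRel_inj h4
  subst h5 h6
  rfl

/-- The ordered path `p` visits its vertices in an order that obeys all precedence constraints. -/
def Extends (I : OrderedGraph) {a b : Fin I.n} (p : I.G.Walk a b) : Prop :=
  ∀ i j, i ≤ p.length → j ≤ p.length → I.prec (p.getVert i) (p.getVert j) → i ≤ j

/-- There is an ordered Hamiltonian path that extends the partial order. -/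
def HasHamPath (I : OrderedGraph) : Prop :=
  ∃ (a b : Fin I.n) (p : I.G.Walk a b), p.IsHamiltonian ∧ I.Extends p

/-- There is an ordered Hamiltonian path that extends the partial order and whose first and last
vertex are adjacent. -/
def HasHamCycle (I : OrderedGraph) : Prop :=
  ∃ (a b : Fin I.n) (p : I.G.Walk a b), p.IsHamiltonian ∧ I.G.Adj a b ∧ I.Extends p

end OrderedGraph

/-- The Partially Ordered Hamiltonian Path Problem, parameterized by a graph parameter. -/
noncomputable def POHPP (ξ : ∀ {V : Type}, SimpleGraph V → ℕ) : ParamProblem where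
  Inst := OrderedGraph
  enc := OrderedGraph.enc
  enc_injective := OrderedGraph.enc_injective
  yes := OrderedGraph.HasHamPath
  param I := ξ I.G

/-- The Partially Ordered Hamiltonian Cycle Problem, parameterized by a graph parameter. -/
noncomputable def POHCP (ξ : ∀ {V : Type}, SimpleGraph V → ℕ) : ParamProblem where
  Inst := OrderedGraph
  enc := OrderedGraph.enc
  enc_injective := OrderedGraph.enc_injective
  yes := OrderedGraph.HasHamCycle
  param I := ξ I.G

end POH

namespace POH

/-! ### Polynomially bounded resources -/

/-! Weighted satisfiability of `d`-CNF formulas is reduced in polynomial time to a selection problem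
(`Selectable`): choose an item from each of a few lists so that no item from a list on side `false`
conflicts with one from a list on side `true`. This problem is then turned into an ordered graph.

Formula to selection. A set of `k` variables is coded by its sorted values, framed by `0` and `n +
1`. Each value has its own list on side `true`. Each `d`-tuple of indices has a list on side
`false`, whose items guess the `d` intervals between consecutive values that the tuple names. A
false literal is refuted by a single interval, so a false clause of width at most `d` is refuted by
some `d`-tuple of intervals. Dropping the guesses that refute a clause therefore enforces
satisfaction (`CNFInst.selectable_iff`). The number of lists, `(k + 1) ^ d + (k + 2)`, depends on
`k` and `d` only.

Selection to graph. Each list becomes a stretch: a path through its items, with an extra vertex at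
both ends. A bounded number of slots per stretch, each with an entry and an exit adjacent to the
whole stretch, are traversed in a fixed linear order divided into phases. The partial order confines
the ends of a `false` stretch to phases 1–2 and those of a `true` stretch to phases 3–4. The slot of
a `false` stretch in phase 3, and that of a `true` stretch in phase 2, must then be entered at an
item, and this item is the selected one. A conflict demands that the `false` item precede the `true`
item, which contradicts the phases (`selectable_of_hasHamPath`). Conversely, a selected item cuts
its stretch into a left part, the item and a right part. The outer parts are visited in phase 1 or
4, and all precedences hold (`hasHamCycle_of_selectable`). The first and last slot vertices are
adjacent, so the same graph serves for paths and cycles.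

Parameters. Deleting the slot vertices leaves the stretches. If these are linked, the rest is a
path. If not, each of them is a component, and it is a module because a slot vertex sees only the
number of a stretch.

Complexity. `PT` is a class of polynomial-time functions closed under pairing, case distinction and
bounded folds, so membership follows from the shape of a definition. `w1Hard_of_polyTime` composes
such a function with an arbitrary fpt-reduction. -/

def PTree.size : PTree → ℕ
  | nil => 1
  | cons a b => a.size + b.size + 1

theorem PTree.one_le_size (t : PTree) : 1 ≤ t.size := by
  cases t <;> simp [PTree.size]

/-- Types whose elements are represented in the memory of the machine. -/
class TreeEnc (α : Type) where
  tree : α → PTree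

open TreeEnc (tree)

def natTree : ℕ → PTree
  | 0 => .nil
  | n + 1 => .cons .nil (natTree n)

def listTree {α : Type} [TreeEnc α] : List α → PTree
  | [] => .nil
  | a :: l => .cons (tree a) (listTree l)

instance : TreeEnc Unit := ⟨fun _ => .nil⟩
instance : TreeEnc ℕ := ⟨natTree⟩
instance : TreeEnc Bool := ⟨PTree.ofBit⟩
instance {α β : Type} [TreeEnc α] [TreeEnc β] : TreeEnc (α × β) :=
  ⟨fun p => .cons (tree p.1) (tree p.2)⟩
instance {α : Type} [TreeEnc α] : TreeEnc (List α) := ⟨listTree⟩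

theorem tree_list_bool (w : List Bool) : tree w = PTree.ofWord w := by
  induction w with
  | nil => rfl
  | cons b w ih => exact congrArg (PTree.cons _) ih

section
variable {α β γ σ : Type} [TreeEnc α] [TreeEnc β] [TreeEnc γ] [TreeEnc σ]

/-- The size of the representation. -/
def sz (a : α) : ℕ := (tree a).size

theorem one_le_sz (a : α) : 1 ≤ sz a := PTree.one_le_size _

@[simp] theorem sz_pair (a : α) (b : β) : sz (a, b) = sz a + sz b + 1 := rfl
@[simp] theorem sz_nil : sz ([] : List α) = 1 := rfl
@[simp] theorem sz_cons (a : α) (l : List α) : sz (a :: l) = sz a + sz l + 1 := rfl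
theorem sz_nat (n : ℕ) : sz n = 2 * n + 1 := by
  induction n with
  | zero => rfl
  | succ n ih =>
    have : sz (n + 1) = 1 + sz n + 1 := rfl
    omega
theorem sz_bool_le (b : Bool) : sz b ≤ 3 := by cases b <;> decide

theorem sz_append (l l' : List α) : sz (l ++ l') + 1 = sz l + sz l' := by
  induction l with
  | nil => simp; omega
  | cons a l ih => simp only [List.cons_append, sz_cons]; omega

theorem length_lt_sz (l : List α) : l.length < sz l := by
  induction l with
  | nil => simp
  | cons a l ih => simp only [List.length_cons, sz_cons]; omega

theorem sz_le_of_mem {l : List α} {a : α} (h : a ∈ l) : sz a ≤ sz l := by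
  induction l with
  | nil => simp at h
  | cons b l ih =>
    rcases List.mem_cons.1 h with rfl | h
    · simp only [sz_cons]; omega
    · have := ih h; simp only [sz_cons]; omega

/-- `T a` is bounded by a polynomial in the size of `a`. -/
def PolyBounded (T : α → ℕ) : Prop := ∃ e, ∀ a, T a ≤ (sz a + 2) ^ e

namespace PolyBounded

theorem mono {T T' : α → ℕ} (h : PolyBounded T') (hT : ∀ a, T a ≤ T' a) : PolyBounded T :=
  let ⟨e, he⟩ := h
  ⟨e, fun a => (hT a).trans (he a)⟩

/-- The base `sz a + 2` is at least 2, so constants and constant factors are absorbed by the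
exponent. -/
theorem const (n : ℕ) : PolyBounded (fun _ : α => n) :=
  ⟨n, fun a => (Nat.lt_two_pow_self).le.trans (Nat.pow_le_pow_left (by omega) n)⟩

theorem size : PolyBounded (fun a : α => sz a) := ⟨1, fun a => by simp⟩

theorem add {T T' : α → ℕ} (h : PolyBounded T) (h' : PolyBounded T') :
    PolyBounded (fun a => T a + T' a) := by
  obtain ⟨e, he⟩ := h
  obtain ⟨e', he'⟩ := h'
  refine ⟨max e e' + 1, fun a => ?_⟩
  have h1 : (sz a + 2) ^ e ≤ (sz a + 2) ^ (max e e') :=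
    Nat.pow_le_pow_right (by omega) (le_max_left _ _)
  have h2 : (sz a + 2) ^ e' ≤ (sz a + 2) ^ (max e e') :=
    Nat.pow_le_pow_right (by omega) (le_max_right _ _)
  calc T a + T' a ≤ 2 * (sz a + 2) ^ (max e e') := by have := he a; have := he' a; omega
    _ ≤ (sz a + 2) * (sz a + 2) ^ (max e e') := Nat.mul_le_mul_right _ (by omega)
    _ = _ := by rw [pow_succ, mul_comm]

theorem mul {T T' : α → ℕ} (h : PolyBounded T) (h' : PolyBounded T') :
    PolyBounded (fun a => T a * T' a) := by
  obtain ⟨e, he⟩ := h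
  obtain ⟨e', he'⟩ := h'
  exact ⟨e + e', fun a => by rw [pow_add]; exact Nat.mul_le_mul (he a) (he' a)⟩

theorem pow {T : α → ℕ} (h : PolyBounded T) (d : ℕ) : PolyBounded (fun a => T a ^ d) := by
  obtain ⟨e, he⟩ := h
  exact ⟨e * d, fun a => by rw [pow_mul]; exact Nat.pow_le_pow_left (he a) d⟩

theorem comp {T : β → ℕ} {f : α → β} (h : PolyBounded T) (hf : PolyBounded (fun a => sz (f a))) :
    PolyBounded (fun a => T (f a)) := by
  obtain ⟨e, he⟩ := h
  exact ((hf.add (const 2)).pow e).mono fun a => he (f a)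

end PolyBounded

/-! ### Commands with a time bound and a postcondition -/

/-- Started in `s`, the command `c` halts within `T` steps in a store that satisfies `Q`. -/
def Does (c : Cmd) (s : Store) (T : ℕ) (Q : Store → Prop) : Prop :=
  ∃ t s', t ≤ T ∧ Runs c s t s' ∧ Q s'

namespace Does

variable {c c₁ c₂ : Cmd} {s : Store} {T T' T₁ T₂ : ℕ} {Q Q' Q₁ Q₂ : Store → Prop}

theorem seq (h : Does c₁ s T₁ Q₁) (h' : ∀ s', Q₁ s' → Does c₂ s' T₂ Q₂) :
    Does (.seq c₁ c₂) s (T₁ + T₂) Q₂ := by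
  obtain ⟨t, s', ht, hr, hq⟩ := h
  obtain ⟨t', s'', ht', hr', hq'⟩ := h' s' hq
  exact ⟨t + t', s'', add_le_add ht ht', .seq hr hr', hq'⟩

theorem mono (h : Does c s T Q) (hT : T ≤ T') (hQ : ∀ s', Q s' → Q' s') : Does c s T' Q' :=
  let ⟨t, s', ht, hr, hq⟩ := h
  ⟨t, s', ht.trans hT, hr, hQ _ hq⟩

theorem copy (x y : ℕ) : Does (.copy x y) s 1 (· = Function.update s x (s y)) :=
  ⟨1, _, le_rfl, .copy _ _ _, rfl⟩
theorem head (x y : ℕ) : Does (.head x y) s 1 (· = Function.update s x (s y).head) :=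
  ⟨1, _, le_rfl, .head _ _ _, rfl⟩
theorem tail (x y : ℕ) : Does (.tail x y) s 1 (· = Function.update s x (s y).tail) :=
  ⟨1, _, le_rfl, .tail _ _ _, rfl⟩
theorem cons (x y z : ℕ) : Does (.cons x y z) s 1 (· = Function.update s x (.cons (s y) (s z))) :=
  ⟨1, _, le_rfl, .cons _ _ _ _, rfl⟩
theorem setNil (x : ℕ) : Does (.setNil x) s 1 (· = Function.update s x .nil) :=
  ⟨1, _, le_rfl, .setNil _ _, rfl⟩
theorem skip : Does .skip s 1 (· = s) :=
  ⟨1, _, le_rfl, .skip _, rfl⟩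

end Does

/-! ### Polynomial-time functions -/

/-- `f` is computed in polynomial time, with values of polynomial size, by programs that work in
the variables from `b` on, with input and output in `b`, and may leave rubbish in the variables
above `b`. -/
@[fun_prop] def PT (f : α → β) : Prop :=
  ∃ (c : ℕ → Cmd) (T : α → ℕ), PolyBounded T ∧ PolyBounded (fun a => sz (f a)) ∧
    ∀ b s a, s b = tree a →
      Does (c b) s (T a) fun s' => s' b = tree (f a) ∧ ∀ x < b, s' x = s x

namespace PT

theorem size_le {f : α → β} (h : PT f) : PolyBounded (fun a => sz (f a)) :=
  let ⟨_, _, _, h, _⟩ := h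
  h

/-- Reinterpreting a tree at another type costs nothing. List cells, successors and the constructors
and projections of structures are obtained in this way from pairs. -/
theorem of_tree_eq {f : α → β} (h : ∀ a, tree (f a) = tree a) : PT f := by
  refine ⟨fun _ => .skip, fun _ => 1, .const 1, PolyBounded.size.mono fun a => ?_, ?_⟩
  · rw [sz, h, sz]
  · intro b s a hs
    exact Does.skip.mono le_rfl fun s' hs' => by subst hs'; exact ⟨by rw [hs, h], fun _ _ => rfl⟩

@[fun_prop] theorem id : PT (fun a : α => a) := of_tree_eq fun _ => rfl

@[fun_prop] theorem comp {g : β → γ} {f : α → β} (hg : PT g) (hf : PT f) : PT (fun a => g (f a)) := by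
  obtain ⟨c, T, hT, hS, h⟩ := hf
  obtain ⟨c', T', hT', hS', h'⟩ := hg
  refine ⟨fun b => .seq (c b) (c' b), fun a => T a + T' (f a), hT.add (hT'.comp hS),
    hS'.comp hS, fun b s a hs => ?_⟩
  refine (h b s a hs).seq fun s' ⟨h1, h2⟩ => (h' b s' _ h1).mono le_rfl ?_
  rintro s'' ⟨h3, h4⟩
  exact ⟨h3, fun x hx => (h4 x hx).trans (h2 x hx)⟩

theorem congr {f g : α → β} (hf : PT f) (h : ∀ a, g a = f a) : PT g := by
  rwa [show g = f from funext h]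

/-- Evaluate `f` on a copy of the variable `b`, in a scratch variable `x > b`. -/
theorem eval_copy {f : α → β} {c : ℕ → Cmd} {T : ℕ} {a : α} {b x : ℕ} {s : Store}
    (hs : s b = tree a)
    (h : ∀ s : Store, s x = tree a →
      Does (c x) s T fun s' => s' x = tree (f a) ∧ ∀ y < x, s' y = s y) :
    Does (.seq (.copy x b) (c x)) s (1 + T)
      fun s' => s' x = tree (f a) ∧ ∀ y < x, s' y = s y := by
  refine (Does.copy x b).seq fun s' hs' => ?_
  subst hs'
  refine (h _ (by simp [hs])).mono le_rfl ?_
  rintro s'' ⟨h1, h2⟩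
  refine ⟨h1, fun y hy => ?_⟩
  rw [h2 y hy, Function.update_of_ne hy.ne]

@[fun_prop] theorem pair {f : α → β} {g : α → γ} (hf : PT f) (hg : PT g) : PT (fun a => (f a, g a)) := by
  obtain ⟨c, T, hT, hS, h⟩ := hf
  obtain ⟨c', T', hT', hS', h'⟩ := hg
  refine ⟨fun b => .seq (.seq (.copy (b + 1) b) (c (b + 1)))
      (.seq (.seq (.copy (b + 2) b) (c' (b + 2))) (.cons b (b + 1) (b + 2))),
    fun a => (1 + T a) + ((1 + T' a) + 1),
    ((PolyBounded.const 1).add hT).add (((PolyBounded.const 1).add hT').add (.const 1)),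
    (hS.add hS').add (.const 1), fun b s a hs => ?_⟩
  refine (eval_copy hs fun s => h (b + 1) s a).seq fun s1 ⟨h1, h2⟩ => ?_
  refine (eval_copy (a := a) ((h2 b (by omega)).trans hs)
    fun s => h' (b + 2) s a).seq fun s2 ⟨h3, h4⟩ => ?_
  refine (Does.cons _ _ _).mono le_rfl fun s3 hs3 => ?_
  subst hs3
  refine ⟨?_, fun x hx => ?_⟩
  · simp only [Function.update_self, h3, h4 (b + 1) (by omega), h1]
    rfl
  · rw [Function.update_of_ne hx.ne, h4 x (by omega), h2 x (by omega)]

@[fun_prop] theorem fst : PT (fun p : α × β => p.1) := by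
  refine ⟨fun b => .head b b, fun _ => 1, .const 1, PolyBounded.size.mono fun p => ?_, ?_⟩
  · rw [show sz p = sz p.1 + sz p.2 + 1 from rfl]
    dsimp only
    omega
  · intro b s p hs
    refine (Does.head b b).mono le_rfl fun s' hs' => ?_
    subst hs'
    exact ⟨by rw [Function.update_self, hs]; rfl, fun x hx => Function.update_of_ne hx.ne _ _⟩

@[fun_prop] theorem snd : PT (fun p : α × β => p.2) := by
  refine ⟨fun b => .tail b b, fun _ => 1, .const 1, PolyBounded.size.mono fun p => ?_, ?_⟩
  · rw [show sz p = sz p.1 + sz p.2 + 1 from rfl]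
    dsimp only
    omega
  · intro b s p hs
    refine (Does.tail b b).mono le_rfl fun s' hs' => ?_
    subst hs'
    exact ⟨by rw [Function.update_self, hs]; rfl, fun x hx => Function.update_of_ne hx.ne _ _⟩

@[fun_prop] theorem fst' {f : α → β × γ} (h : PT f) : PT (fun a => (f a).1) := fst.comp h
@[fun_prop] theorem snd' {f : α → β × γ} (h : PT f) : PT (fun a => (f a).2) := snd.comp h

/-- A program that creates a fixed tree. -/
def build : PTree → ℕ → Cmd
  | .nil, b => .setNil b
  | .cons l r, b => .seq (build l (b + 1)) (.seq (build r (b + 2)) (.cons b (b + 1) (b + 2)))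

theorem build_does (t : PTree) : ∀ (b : ℕ) (s : Store),
    Does (build t b) s (2 * t.size) fun s' => s' b = t ∧ ∀ x < b, s' x = s x := by
  induction t with
  | nil =>
    intro b s
    refine (Does.setNil b).mono (by simp [PTree.size]) fun s' hs' => ?_
    subst hs'
    exact ⟨by simp, fun x hx => Function.update_of_ne hx.ne _ _⟩
  | cons l r ihl ihr =>
    intro b s
    refine Does.mono ((ihl (b + 1) s).seq fun s1 ⟨h1, h2⟩ => (ihr (b + 2) s1).seq
      fun s2 ⟨h3, h4⟩ => Does.cons b (b + 1) (b + 2) (s := s2) |>.mono le_rfl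
        fun s3 hs3 => (show s3 b = .cons l r ∧ ∀ x < b, s3 x = s x from ?_))
      (by simp only [PTree.size]; omega) fun _ h => h
    subst hs3
    refine ⟨by simp [h3, h4 (b + 1) (by omega), h1], fun x hx => ?_⟩
    rw [Function.update_of_ne hx.ne, h4 x (by omega), h2 x (by omega)]

@[fun_prop] theorem const (b : β) : PT (fun _ : α => b) :=
  ⟨build (tree b), fun _ => 2 * sz b, .const _, .const _,
    fun x s _ _ => build_does (tree b) x s⟩

@[fun_prop] theorem ite {c : α → Bool} {f g : α → β} (hc : PT c) (hf : PT f) (hg : PT g) :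
    PT (fun a => if c a = true then f a else g a) := by
  obtain ⟨cc, Tc, hTc, -, hc⟩ := hc
  obtain ⟨cf, Tf, hTf, hSf, hf⟩ := hf
  obtain ⟨cg, Tg, hTg, hSg, hg⟩ := hg
  refine ⟨fun b => .seq (.seq (.copy (b + 1) b) (cc (b + 1))) (.ite (b + 1) (cf b) (cg b)),
    fun a => (1 + Tc a) + (Tf a + Tg a + 1),
    ((PolyBounded.const 1).add hTc).add ((hTf.add hTg).add (.const 1)),
    (hSf.add hSg).mono fun a => by dsimp only; split <;> omega, fun b s a hs => ?_⟩
  refine (eval_copy hs fun s => hc (b + 1) s a).seq fun s1 ⟨h1, h2⟩ => ?_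
  have hb : s1 b = tree a := (h2 b (by omega)).trans hs
  cases hca : c a with
  | true =>
    obtain ⟨t, s', ht, hr, h3, h4⟩ := hf b s1 a hb
    refine ⟨t + 1, s', by omega, .iteTrue (by rw [h1, hca]; exact PTree.noConfusion) hr, ?_, ?_⟩
    · simp [h3, hca]
    · exact fun x hx => (h4 x hx).trans (h2 x (by omega))
  | false =>
    obtain ⟨t, s', ht, hr, h3, h4⟩ := hg b s1 a hb
    refine ⟨t + 1, s', by omega, .iteFalse (by rw [h1, hca]; rfl) hr, ?_, ?_⟩
    · simp [h3, hca]
    · exact fun x hx => (h4 x hx).trans (h2 x (by omega))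

/-- Variable `b` keeps `a`, `b + 1` the rest of the list, `b + 2` the accumulator, and `b + 4`
receives the current element. The program `c` works from `b + 3` on, so its rubbish is harmless. A
round costs `M`, five single steps and the loop test. The bound `M` is required only for
accumulators that arise from prefixes of the list. -/
theorem loop_does {c : ℕ → Cmd} {F : σ → β → σ} {a : α} {M : ℕ} (l : List β) :
    ∀ (acc : σ) (b : ℕ) (s : Store),
    (∀ l₁ x l₂, l = l₁ ++ x :: l₂ → ∀ s : Store,
      s (b + 3) = tree (a, l₁.foldl F acc, x) →
      Does (c (b + 3)) s M fun s' => s' (b + 3) = tree (F (l₁.foldl F acc) x) ∧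
        ∀ y < b + 3, s' y = s y) →
    s b = tree a → s (b + 1) = tree l → s (b + 2) = tree acc →
    Does (.loop (b + 1) (.seq (.head (b + 4) (b + 1)) (.seq (.cons (b + 3) (b + 2) (b + 4))
      (.seq (.cons (b + 3) b (b + 3)) (.seq (c (b + 3)) (.seq (.copy (b + 2) (b + 3))
        (.tail (b + 1) (b + 1)))))))) s (1 + l.length * (M + 6))
      fun s' => s' (b + 2) = tree (l.foldl F acc) ∧ ∀ y < b, s' y = s y := by
  induction l with
  | nil =>
    intro acc b s _ _ h1 h2
    exact ⟨1, s, by omega, .loopDone h1, h2, fun _ _ => rfl⟩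
  | cons x l ih =>
    intro acc b s hF h0 h1 h2
    have hbody : Does (.seq (.head (b + 4) (b + 1)) (.seq (.cons (b + 3) (b + 2) (b + 4))
        (.seq (.cons (b + 3) b (b + 3)) (.seq (c (b + 3)) (.seq (.copy (b + 2) (b + 3))
        (.tail (b + 1) (b + 1))))))) s (1 + (1 + (1 + (M + (1 + 1)))))
        fun s' => s' (b + 1) = tree l ∧ s' (b + 2) = tree (F acc x) ∧ s' b = tree a ∧
          ∀ y < b, s' y = s y := by
      refine (Does.head _ _).seq fun s1 e1 => (Does.cons _ _ _).seq fun s2 e2 =>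
        (Does.cons _ _ _).seq fun s3 e3 => ?_
      have hs3 : s3 (b + 3) = tree (a, acc, x) := by
        subst e3 e2 e1
        simp only [Function.update_self,
          Function.update_of_ne (show b ≠ b + 3 by omega),
          Function.update_of_ne (show b ≠ b + 4 by omega),
          Function.update_of_ne (show b + 2 ≠ b + 4 by omega), h0, h1, h2]
        rfl
      have hs3' : ∀ y < b + 3, s3 y = s y := by
        subst e3 e2 e1
        intro y hy
        simp only [Function.update_of_ne (show y ≠ b + 3 by omega),
          Function.update_of_ne (show y ≠ b + 4 by omega)]
      refine (hF [] x l rfl s3 hs3).seq fun s4 ⟨h4, h5⟩ => (Does.copy _ _).seq fun s5 e5 =>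
        (Does.tail _ _).mono le_rfl fun s6 e6 => ?_
      subst e6 e5
      refine ⟨?_, ?_, ?_, fun y hy => ?_⟩
      · simp only [Function.update_self, Function.update_of_ne (show b + 1 ≠ b + 2 by omega),
          h5 (b + 1) (by omega), hs3' (b + 1) (by omega), h1]
        rfl
      · simp only [Function.update_self, Function.update_of_ne (show b + 2 ≠ b + 1 by omega), h4]
        rfl
      · simp only [Function.update_of_ne (show b ≠ b + 2 by omega),
          Function.update_of_ne (show b ≠ b + 1 by omega), h5 b (by omega), hs3' b (by omega), h0]
      · simp only [Function.update_of_ne (show y ≠ b + 2 by omega),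
          Function.update_of_ne (show y ≠ b + 1 by omega), h5 y (by omega), hs3' y (by omega)]
    obtain ⟨t, s', ht, hr, h3, h4, h5, h6⟩ := hbody
    obtain ⟨t', s'', ht', hr', h7, h8⟩ := ih (F acc x) b s' (fun l₁ y l₂ e s hs => by
      have := hF (x :: l₁) y l₂ (by rw [e]; rfl) s
      simp only [List.foldl_cons] at this
      exact this hs) h5 h3 h4
    refine ⟨t + t' + 1, s'', ?_, .loopStep (by rw [h1]; exact PTree.noConfusion) hr hr', h7,
      fun y hy => (h8 y hy).trans (h6 y hy)⟩
    rw [List.length_cons, Nat.succ_mul]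
    omega

/-- Left folds, if all intermediate results have polynomial size. -/
theorem foldl {l : α → List β} {init : α → σ} {F : α → σ → β → σ} {B : α → ℕ}
    (hl : PT l) (hi : PT init) (hF : PT (fun p : α × σ × β => F p.1 p.2.1 p.2.2))
    (hB : PolyBounded B)
    (h : ∀ a l', l' <+: l a → sz (l'.foldl (F a) (init a)) ≤ B a) :
    PT (fun a => (l a).foldl (F a) (init a)) := by
  obtain ⟨cl, Tl, hTl, hSl, hl⟩ := hl
  obtain ⟨ci, Ti, hTi, -, hi⟩ := hi
  obtain ⟨c, T, ⟨e, he⟩, -, hF⟩ := hF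
  -- Cells share subtrees, so a cheap step may double the size of the accumulator. Only the assumed
  -- bound `B` on the intermediate results keeps the time of each round polynomial.
  have hM : PolyBounded (fun a => (sz a + (B a + sz (l a) + 1) + 3) ^ e) :=
    ((PolyBounded.size.add ((hB.add hSl).add (.const 1))).add (.const 3)).pow e
  refine ⟨fun b => .seq (.seq (.copy (b + 1) b) (cl (b + 1))) (.seq (.seq (.copy (b + 2) b)
      (ci (b + 2))) (.seq (.loop (b + 1) (.seq (.head (b + 4) (b + 1))
        (.seq (.cons (b + 3) (b + 2) (b + 4))
      (.seq (.cons (b + 3) b (b + 3)) (.seq (c (b + 3)) (.seq (.copy (b + 2) (b + 3))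
        (.tail (b + 1) (b + 1)))))))) (.copy b (b + 2)))),
    fun a => (1 + Tl a) + ((1 + Ti a) + ((1 + sz (l a) *
      ((sz a + (B a + sz (l a) + 1) + 3) ^ e + 6)) + 1)),
    ((PolyBounded.const 1).add hTl).add (((PolyBounded.const 1).add hTi).add
      (((PolyBounded.const 1).add (hSl.mul (hM.add (.const 6)))).add (.const 1))),
    hB.mono fun a => h a _ List.prefix_rfl, fun b s a hs => ?_⟩
  refine (eval_copy hs fun s => hl (b + 1) s a).seq fun s1 ⟨h1, h2⟩ => ?_
  refine (eval_copy (a := a) ((h2 b (by omega)).trans hs)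
    fun s => hi (b + 2) s a).seq fun s2 ⟨h3, h4⟩ => ?_
  have hloop := loop_does (c := c) (F := F a) (a := a)
    (M := (sz a + (B a + sz (l a) + 1) + 3) ^ e) (l a) (init a) b s2 (by
      intro l₁ x l₂ hl' s hs
      refine (hF (b + 3) s (a, l₁.foldl (F a) (init a), x) hs).mono ((he _).trans ?_)
        fun _ h => h
      refine Nat.pow_le_pow_left ?_ e
      have hx : sz x ≤ sz (l a) := sz_le_of_mem (by rw [hl']; simp)
      have := h a l₁ (by rw [hl']; exact List.prefix_append _ _)
      simp only [sz_pair]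
      omega)
    ((h4 b (by omega)).trans ((h2 b (by omega)).trans hs))
    ((h4 (b + 1) (by omega)).trans h1) h3
  refine (hloop.mono (T' := 1 + sz (l a) * ((sz a + (B a + sz (l a) + 1) + 3) ^ e + 6))
    (Nat.add_le_add_left (Nat.mul_le_mul_right _ (length_lt_sz _).le) _) fun _ h => h).seq
    fun s3 ⟨h5, h6⟩ => (Does.copy _ _).mono le_rfl fun s4 e4 => ?_
  subst e4
  refine ⟨by rw [Function.update_self, h5], fun x hx => ?_⟩
  rw [Function.update_of_ne hx.ne, h6 x hx, h4 x (by omega), h2 x (by omega)]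

/-- Left folds, if every step adds a polynomial amount to the size. -/
theorem foldl_growth {l : α → List β} {init : α → σ} {F : α → σ → β → σ} {G : α × β → ℕ}
    (hl : PT l) (hi : PT init) (hF : PT (fun p : α × σ × β => F p.1 p.2.1 p.2.2))
    (hG : PolyBounded G) (h : ∀ a acc x, sz (F a acc x) ≤ sz acc + G (a, x)) :
    PT (fun a => (l a).foldl (F a) (init a)) := by
  obtain ⟨e, he⟩ := hG
  refine foldl (B := fun a => sz (init a) + sz (l a) * (sz a + sz (l a) + 3) ^ e) hl hi hF
    (hi.size_le.add (hl.size_le.mul (((PolyBounded.size.add hl.size_le).add (.const 3)).pow e)))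
    fun a l' hl' => ?_
  have key : ∀ (l' : List β) (acc : σ), (∀ x ∈ l', x ∈ l a) →
      sz (l'.foldl (F a) acc) ≤ sz acc + l'.length * (sz a + sz (l a) + 3) ^ e := by
    intro l'
    induction l' with
    | nil => simp
    | cons x l' ih =>
      intro acc hx
      have h1 := ih (F a acc x) fun y hy => hx y (List.mem_cons_of_mem _ hy)
      have h2 := h a acc x
      have h3 : G (a, x) ≤ (sz a + sz (l a) + 3) ^ e := (he _).trans <| by
        refine Nat.pow_le_pow_left ?_ e
        have := sz_le_of_mem (hx x List.mem_cons_self)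
        simp only [sz_pair]; omega
      rw [List.foldl_cons, List.length_cons, Nat.succ_mul]
      omega
  refine (key l' (init a) fun x hx => hl'.subset hx).trans (Nat.add_le_add_left ?_ _)
  exact Nat.mul_le_mul_right _ (hl'.length_le.trans (length_lt_sz _).le)

end PT
end
end POH

/-! ### Polynomial-time arithmetic and list operations -/

namespace POH
open TreeEnc (tree)
section
variable {α β γ σ : Type} [TreeEnc α] [TreeEnc β] [TreeEnc γ] [TreeEnc σ]

namespace PT

@[fun_prop] theorem list_cons {f : α → β} {g : α → List β} (hf : PT f) (hg : PT g) :
    PT (fun a => f a :: g a) :=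
  (of_tree_eq (f := fun p : β × List β => p.1 :: p.2) fun _ => rfl).comp (hf.pair hg)

@[fun_prop] theorem succ {f : α → ℕ} (hf : PT f) : PT (fun a => f a + 1) :=
  (of_tree_eq (f := fun p : Unit × ℕ => p.2 + 1) fun _ => rfl).comp ((const ()).pair hf)

@[fun_prop] theorem pred {f : α → ℕ} (hf : PT f) : PT (fun a => f a - 1) := by
  refine comp (g := fun n : ℕ => n - 1) ⟨fun b => .tail b b, fun _ => 1, .const 1,
    PolyBounded.size.mono fun n => ?_, fun b s n hs => ?_⟩ hf
  · simp only [sz_nat]; omega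
  · refine (Does.tail b b).mono le_rfl fun s' hs' => ?_
    subst hs'
    refine ⟨?_, fun x hx => Function.update_of_ne hx.ne _ _⟩
    rw [Function.update_self, hs]
    cases n <;> rfl

/-- The test of the machine. -/
theorem test {f : α → β} (hf : PT f) (p : β → Bool) (hp : ∀ b, p b = true ↔ tree b ≠ .nil) :
    PT (fun a => p (f a)) := by
  refine comp (g := p) ⟨fun b => .ite b (build (tree true) b) (.setNil b), fun _ => 7, .const _,
    (PolyBounded.const 3).mono fun b => sz_bool_le _, fun b s n hs => ?_⟩ hf
  cases h : p n with
  | true =>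
    obtain ⟨t, s', ht, hr, h1, h2⟩ := build_does (tree true) b s
    exact ⟨t + 1, s', by simp only [tree, PTree.ofBit, PTree.size] at ht; dsimp only; omega,
      .iteTrue (by rw [hs]; exact (hp n).1 h) hr, h1, h2⟩
  | false =>
    refine ⟨2, _, by dsimp only; omega, .iteFalse ?_ (.setNil b s), Function.update_self .., fun x hx =>
      Function.update_of_ne hx.ne _ _⟩
    rw [hs]
    by_contra h'
    simp [(hp n).2 h'] at h

@[fun_prop] theorem eq_zero {f : α → ℕ} (hf : PT f) : PT (fun a => f a == 0) := by
  have h := test hf (fun n => !(n == 0)) fun n => by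
    cases n with
    | zero => simp [tree, natTree]
    | succ n => simp [tree, natTree]
  refine (h.ite (const false) (const true)).congr fun a => ?_
  cases h : f a == 0 <;> simp

@[fun_prop] theorem and {f g : α → Bool} (hf : PT f) (hg : PT g) : PT (fun a => f a && g a) :=
  (hf.ite hg (const false)).congr fun a => by cases f a <;> rfl

@[fun_prop] theorem or {f g : α → Bool} (hf : PT f) (hg : PT g) : PT (fun a => f a || g a) :=
  (hf.ite (const true) hg).congr fun a => by cases f a <;> rfl

@[fun_prop] theorem not {f : α → Bool} (hf : PT f) : PT (fun a => !f a) :=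
  (hf.ite (const false) (const true)).congr fun a => by cases f a <;> rfl

@[fun_prop] theorem reverse {l : α → List β} (hl : PT l) : PT (fun a => (l a).reverse) := by
  refine (foldl_growth (init := fun _ => []) (F := fun _ acc x => x :: acc)
    (G := fun p => sz p.2 + 1) hl (const _) (by fun_prop)
    ((snd.size_le).add (.const 1)) fun a acc x => by simp; omega).congr fun a => ?_
  have h : ∀ l acc : List β, l.foldl (fun acc x => x :: acc) acc = l.reverse ++ acc := by
    intro l
    induction l with
    | nil => simp
    | cons x l ih => intro acc; simp [ih]
  rw [h]; simp

@[fun_prop] theorem append {l l' : α → List β} (hl : PT l) (hl' : PT l') :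
    PT (fun a => l a ++ l' a) := by
  refine (foldl_growth (init := l') (F := fun _ acc x => x :: acc) (G := fun p => sz p.2 + 1)
    hl.reverse hl' (by fun_prop)
    ((snd.size_le).add (.const 1)) fun a acc x => by simp; omega).congr fun a => ?_
  have h : ∀ l acc : List β, l.foldl (fun acc x => x :: acc) acc = l.reverse ++ acc := by
    intro l
    induction l with
    | nil => simp
    | cons x l ih => intro acc; simp [ih]
  rw [h]; simp

@[fun_prop] theorem flatMap {l : α → List β} {f : α → β → List γ} (hl : PT l)
    (hf : PT (fun p : α × β => f p.1 p.2)) : PT (fun a => (l a).flatMap (f a)) := by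
  refine (foldl_growth (init := fun _ => []) (F := fun a acc x => acc ++ f a x)
    (G := fun p => sz (f p.1 p.2)) hl (const _)
    (append (by fun_prop) (hf.comp (f := fun p : α × List γ × β => (p.1, p.2.2)) (by fun_prop)))
    hf.size_le fun a acc x => by
      have := sz_append acc (f a x)
      dsimp only; omega).congr fun a => ?_
  have h : ∀ (l : List β) acc, l.foldl (fun acc x => acc ++ f a x) acc = acc ++ l.flatMap (f a) := by
    intro l
    induction l with
    | nil => simp
    | cons x l ih => intro acc; simp [ih]
  rw [h]; simp

@[fun_prop] theorem map {l : α → List β} {f : α → β → γ} (hl : PT l)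
    (hf : PT (fun p : α × β => f p.1 p.2)) : PT (fun a => (l a).map (f a)) :=
  (flatMap hl (f := fun a x => [f a x]) (hf.list_cons (const []))).congr fun a => by
    induction l a <;> simp_all

@[fun_prop] theorem filter {l : α → List β} {f : α → β → Bool} (hl : PT l)
    (hf : PT (fun p : α × β => f p.1 p.2)) : PT (fun a => (l a).filter (f a)) :=
  (flatMap hl (f := fun a x => if f a x = true then [x] else [])
    (hf.ite (by fun_prop) (const []))).congr fun a => by
    induction l a with
    | nil => rfl
    | cons x l ih => rw [List.filter_cons, ih, List.flatMap_cons]; split <;> simp_all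

@[fun_prop] theorem any {l : α → List β} {f : α → β → Bool} (hl : PT l)
    (hf : PT (fun p : α × β => f p.1 p.2)) : PT (fun a => (l a).any (f a)) := by
  refine (foldl_growth (init := fun _ => false) (F := fun a acc x => acc || f a x)
    (G := fun _ => 3) hl (const _)
    (or (by fun_prop) (hf.comp (f := fun p : α × Bool × β => (p.1, p.2.2)) (by fun_prop)))
    (.const 3) fun a acc x => (sz_bool_le _).trans (by omega)).congr fun a => ?_
  have h : ∀ (l : List β) acc, l.foldl (fun acc x => acc || f a x) acc = (acc || l.any (f a)) := by
    intro l
    induction l with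
    | nil => simp
    | cons x l ih => intro acc; simp [ih, Bool.or_assoc]
  rw [h]; simp

@[fun_prop] theorem all {l : α → List β} {f : α → β → Bool} (hl : PT l)
    (hf : PT (fun p : α × β => f p.1 p.2)) : PT (fun a => (l a).all (f a)) :=
  (any hl (f := fun a x => !f a x) hf.not).not.congr fun a => by
    simp [List.any_eq_not_all_not]

@[fun_prop] theorem replicate {f : α → ℕ} (hf : PT f) (b : β) :
    PT (fun a => List.replicate (f a) b) := by
  -- A unary number and a list of units are the same tree; this transfers list operations to
  -- arithmetic.
  have h : PT (fun n : ℕ => List.replicate n ()) := of_tree_eq fun n => by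
    induction n with
    | zero => rfl
    | succ n ih => exact congrArg (PTree.cons _) ih
  exact ((h.comp hf).map (f := fun _ _ => b) (const b)).congr fun a => by simp

@[fun_prop] theorem length {l : α → List β} (hl : PT l) : PT (fun a => (l a).length) := by
  have h : PT (fun l : List Unit => l.length) := of_tree_eq fun l => by
    induction l with
    | nil => rfl
    | cons x l ih => exact congrArg (PTree.cons _) ih
  exact (h.comp (hl.map (f := fun _ _ => ()) (const ()))).congr fun a => by simp

@[fun_prop] theorem add {f g : α → ℕ} (hf : PT f) (hg : PT g) : PT (fun a => f a + g a) :=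
  ((hf.replicate ()).append (hg.replicate ())).length.congr fun a => by simp

@[fun_prop] theorem sub {f g : α → ℕ} (hf : PT f) (hg : PT g) : PT (fun a => f a - g a) := by
  refine (foldl_growth (init := f) (F := fun _ acc _ => acc - 1) (G := fun _ => 0)
    (hg.replicate ()) hf (by fun_prop) (.const 0) fun a acc x => by
      simp only [sz_nat]; omega).congr fun a => ?_
  have h : ∀ m n : ℕ, (List.replicate m ()).foldl (fun acc _ => acc - 1) n = n - m := by
    intro m
    induction m with
    | zero => simp
    | succ m ih => intro n; rw [List.replicate_succ, List.foldl_cons, ih]; omega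
  rw [h]

@[fun_prop] theorem decide_le {f g : α → ℕ} (hf : PT f) (hg : PT g) :
    PT (fun a => decide (f a ≤ g a)) :=
  (hf.sub hg).eq_zero.congr fun a => by
    by_cases h : f a ≤ g a
    · simp [h, Nat.sub_eq_zero_of_le h]
    · have : ¬ f a - g a = 0 := by omega
      simp [h, this]

@[fun_prop] theorem decide_lt {f g : α → ℕ} (hf : PT f) (hg : PT g) :
    PT (fun a => decide (f a < g a)) := decide_le hf.succ hg

@[fun_prop] theorem beq {f g : α → ℕ} (hf : PT f) (hg : PT g) : PT (fun a => f a == g a) :=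
  ((decide_le hf hg).and (decide_le hg hf)).congr fun a => by
    rw [← Bool.decide_and, Bool.eq_iff_iff]; simp; omega

theorem sz_zipIdx_le (l : List β) (m : ℕ) : sz (l.zipIdx m) ≤ sz l + l.length * (2 * (m + l.length) + 2) := by
  induction l generalizing m with
  | nil => simp
  | cons x l ih =>
    have := ih (m + 1)
    rw [List.zipIdx_cons, sz_cons, sz_pair, sz_cons, sz_nat, List.length_cons]
    have e : m + 1 + l.length = m + (l.length + 1) := by omega
    rw [e] at this
    nlinarith

@[fun_prop] theorem zipIdx {l : α → List β} {m : α → ℕ} (hl : PT l) (hm : PT m) :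
    PT (fun a => (l a).zipIdx (m a)) := by
  have hlen : ∀ (l : List β) (m : ℕ) (acc : List (β × ℕ)),
      l.foldl (fun acc x => acc ++ [(x, m + acc.length)]) acc = acc ++ l.zipIdx (m + acc.length) := by
    intro l m
    induction l with
    | nil => simp
    | cons x l ih => intro acc; simp [ih, List.zipIdx_cons, add_assoc]
  have h0 : ∀ (l : List β) (m : ℕ),
      l.foldl (fun acc x => acc ++ [(x, m + acc.length)]) [] = l.zipIdx m := fun l m => by
    simpa using hlen l m []
  -- The index is read off the accumulator, so the growth of a step depends on the accumulator and
  -- `foldl_growth` does not apply. The intermediate results are `zipIdx` of prefixes and are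
  -- bounded directly.
  refine (foldl (init := fun _ => []) (F := fun a acc x => acc ++ [(x, m a + acc.length)])
    (B := fun a => sz (l a) + sz (l a) * (2 * (sz (m a) + sz (l a)) + 2)) hl (const _)
    ?_ (hl.size_le.add (hl.size_le.mul (((PolyBounded.const 2).mul
      (hm.size_le.add hl.size_le)).add (.const 2)))) fun a l' hl' => ?_).congr fun a => (h0 _ _).symm
  · have : PT (fun p : α × List (β × ℕ) × β => m p.1) := hm.comp fst
    fun_prop
  · rw [h0]
    refine (sz_zipIdx_le _ _).trans ?_
    have h1 : sz l' ≤ sz (l a) := by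
      obtain ⟨t, ht⟩ := hl'
      have := sz_append l' t
      have := one_le_sz t
      rw [← ht]; omega
    have h2 := length_lt_sz l'
    have h3 : m a ≤ sz (m a) := by rw [sz_nat]; omega
    gcongr <;> omega

@[fun_prop] theorem range {f : α → ℕ} (hf : PT f) : PT (fun a => List.range (f a)) :=
  ((hf.replicate ()).zipIdx (const 0)).map (f := fun _ x => x.2) (by fun_prop) |>.congr fun a => by
    simp [List.zipIdx_eq_zip_range', List.range_eq_range', List.map_snd_zip]

@[fun_prop] theorem encNat {f : α → ℕ} (hf : PT f) : PT (fun a => POH.encNat (f a)) := by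
  unfold POH.encNat; fun_prop

end PT
end
end POH

namespace POH
open TreeEnc (tree)

/-! ### Composition with an arbitrary fpt-reduction -/

/-- The maximal length of a list inside of a tree. -/
def PTree.spine : PTree → ℕ
  | nil => 0
  | cons a b => max a.spine (b.spine + 1)

theorem spine_update {s : Store} {m m' : ℕ} {y : ℕ} {v : PTree} (hs : ∀ x, (s x).spine ≤ m)
    (hv : v.spine ≤ m') (h : m ≤ m') (x : ℕ) : (Function.update s y v x).spine ≤ m' := by
  by_cases hx : x = y
  · subst hx; simpa using hv
  · rw [Function.update_of_ne hx]; exact (hs x).trans h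

theorem PTree.spine_head_le (t : PTree) : t.head.spine ≤ t.spine := by
  cases t <;> simp [PTree.head, PTree.spine]

theorem PTree.spine_tail_le (t : PTree) : t.tail.spine ≤ t.spine := by
  cases t <;> simp [PTree.tail, PTree.spine]

/-- Because of sharing, tree sizes can grow exponentially in the running time. The spine grows by at
most one with each new cell, and it bounds the length of a word, so the output of an arbitrary
reduction is no longer than its input and its time allow. -/
theorem Runs.spine_le {c : Cmd} {s s' : Store} {t : ℕ} (h : Runs c s t s') :
    ∀ {m : ℕ}, (∀ x, (s x).spine ≤ m) → ∀ x, (s' x).spine ≤ m + t := by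
  induction h with
  | skip => exact fun hs x => (hs x).trans (by omega)
  | setNil => exact fun hs x => spine_update hs (by simp [PTree.spine]) (by omega) x
  | copy _ y => exact fun hs x => spine_update hs ((hs y).trans (by omega)) (by omega) x
  | cons _ y z =>
    intro m hs x
    refine spine_update hs ?_ (by omega) x
    have := hs y
    have := hs z
    simp only [PTree.spine]; omega
  | head _ y =>
    exact fun hs x => spine_update hs ((PTree.spine_head_le _).trans ((hs y).trans (by omega)))
      (by omega) x
  | tail _ y =>
    exact fun hs x => spine_update hs ((PTree.spine_tail_le _).trans ((hs y).trans (by omega)))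
      (by omega) x
  | seq _ _ ih ih' => exact fun hs x => (ih' (ih hs) x).trans (by omega)
  | iteTrue _ _ ih => exact fun hs x => (ih hs x).trans (by omega)
  | iteFalse _ _ ih => exact fun hs x => (ih hs x).trans (by omega)
  | loopDone => exact fun hs x => (hs x).trans (by omega)
  | loopStep _ _ _ ih ih' => exact fun hs x => (ih' (ih hs) x).trans (by omega)

theorem length_le_spine (w : List Bool) : w.length ≤ (PTree.ofWord w).spine := by
  induction w with
  | nil => simp
  | cons b w ih => simp only [PTree.ofWord, PTree.spine, List.length_cons]; omega

theorem spine_ofWord_le (w : List Bool) : (PTree.ofWord w).spine ≤ w.length + 1 := by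
  induction w with
  | nil => simp [PTree.ofWord, PTree.spine]
  | cons b w ih =>
    have : (PTree.ofBit b).spine ≤ 1 := by cases b <;> simp [PTree.ofBit, PTree.spine]
    simp only [PTree.ofWord, PTree.spine, List.length_cons]; omega

theorem OutputsWithin.length_le {c : Cmd} {w w' : List Bool} {T : ℕ} (h : OutputsWithin c w w' T) :
    w'.length ≤ w.length + 1 + T := by
  obtain ⟨t, s, ht, hr, hs⟩ := h
  have h1 := hr.spine_le (m := w.length + 1) (fun x => spine_update (m := 0) (fun _ => by
    simp [PTree.spine]) (spine_ofWord_le w) (by omega) x) 0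
  rw [hs] at h1
  have := length_le_spine w'
  omega

theorem sz_word_le (w : List Bool) : sz w ≤ 4 * w.length + 1 := by
  induction w with
  | nil => simp
  | cons b w ih =>
    have := sz_bool_le b
    simp only [sz_cons, List.length_cons]; omega

theorem primrec_pow (e : ℕ) : Primrec (fun n : ℕ => n ^ e) := by
  induction e with
  | zero => exact (Primrec.const 1).of_eq fun n => by simp
  | succ e ih => exact (Primrec.nat_mul.comp ih Primrec.id).of_eq fun n => by simp [pow_succ]

/-- The time of a composition. -/
theorem composition_time (f N e E : ℕ) (hN : 1 ≤ N) :
    f * N ^ e + (4 * (N + f * N ^ e) + 3) ^ E ≤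
      (f + (4 * f + 7) ^ E) * N ^ (e + (e + 1) * E) := by
  have h1 : 4 * (N + f * N ^ e) + 3 ≤ (4 * f + 7) * N ^ (e + 1) := by
    have h2 : N ^ e ≤ N ^ (e + 1) := Nat.pow_le_pow_right hN (by omega)
    have h3 : N ≤ N ^ (e + 1) := Nat.le_self_pow (by omega) N
    nlinarith
  have h4 : (4 * (N + f * N ^ e) + 3) ^ E ≤ (4 * f + 7) ^ E * N ^ ((e + 1) * E) := by
    rw [pow_mul, ← mul_pow]; exact Nat.pow_le_pow_left h1 E
  have h5 : N ^ e ≤ N ^ (e + (e + 1) * E) := Nat.pow_le_pow_right hN (by omega)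
  have h6 : N ^ ((e + 1) * E) ≤ N ^ (e + (e + 1) * E) := Nat.pow_le_pow_right hN (by omega)
  rw [add_mul]
  exact add_le_add (Nat.mul_le_mul_left _ h5) (h4.trans (Nat.mul_le_mul_left _ h6))

/-- To show `W[1]`-hardness, it suffices to reduce weighted satisfiability of `d`-CNF formulas in
polynomial time. -/
theorem w1Hard_of_polyTime {P : ParamProblem}
    (h : ∀ d, 1 ≤ d → ∃ (R : CNFInst d → P.Inst) (F : List Bool → List Bool) (g : ℕ → ℕ),
      PT F ∧ (∀ φ, F φ.enc = P.enc (R φ)) ∧ (∀ φ, φ.Yes ↔ P.yes (R φ)) ∧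
      Computable g ∧ Monotone g ∧ ∀ φ, P.param (R φ) ≤ g φ.k) : W1Hard P := by
  rintro Q ⟨d, hd, R₁, c₁, f₁, g₁, e₁, hf₁, hg₁, hyes₁, hparam₁, hrun₁⟩
  obtain ⟨R, F, g, ⟨c, T, ⟨E, hE⟩, -, hc⟩, hF, hyes, hg, hmono, hparam⟩ := h d hd
  refine ⟨fun x => R (R₁ x), .seq c₁ (c 0), fun k => f₁ k + (4 * f₁ k + 7) ^ E,
    fun k => g (g₁ k), e₁ + (e₁ + 1) * E, ?_, hg.comp hg₁, fun x => (hyes₁ x).trans (hyes _),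
    fun x => (hparam _).trans (hmono (hparam₁ x)), fun x => ?_⟩
  · have h1 : Primrec (fun n : ℕ => n + (4 * n + 7) ^ E) :=
      Primrec.nat_add.comp Primrec.id ((primrec_pow E).comp
        (Primrec.nat_add.comp (Primrec.nat_mul.comp (Primrec.const 4) Primrec.id)
          (Primrec.const 7)))
    exact h1.to_comp.comp hf₁
  · have hlen := (hrun₁ x).length_le
    obtain ⟨t, s, ht, hr, hs⟩ := hrun₁ x
    -- The first program may leave rubbish in all variables other than `0`; programs of `PT` assume
    -- nothing about them.
    obtain ⟨t', s', ht', hr', hs', -⟩ := hc 0 s (CNFInst.enc (R₁ x)) (by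
      rw [tree_list_bool]; exact hs)
    refine ⟨t + t', s', ?_, .seq hr hr', 
      hs'.trans ((tree_list_bool _).trans (congrArg _ (hF (R₁ x))))⟩
    refine le_trans (add_le_add ht (ht'.trans ((hE _).trans (Nat.pow_le_pow_left ?_ E))))
      (composition_time (f₁ (Q.param x)) ((Q.enc x).length + 1) e₁ E (by omega))
    -- A word of length `m` has size at most `4 * m + 1`; with the summand 2 from `PolyBounded` this
    -- is the term `4 * (N + f * N ^ e) + 3` of `composition_time`, for `N = |x| + 1`.
    have h1 := sz_word_le (CNFInst.enc (R₁ x))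
    have h2 : (CNFInst.enc (R₁ x)).length ≤ _ := hlen
    omega

end POH

namespace POH
open TreeEnc (tree)

/-! ### The gadget graph -/

/-- Partial assignments: lists of triples `(j, a, b)`. -/
abbrev Item : Type := List (ℕ × ℕ × ℕ)

/-- The items `A` and `B` cannot be selected together: they disagree about the `j`-th or the
`j+1`-st value for some triple `(j, a, b)` of `A`. -/
def conf (A B : Item) : Bool :=
  A.any fun x => B.any fun y =>
    (x.1 == y.1 && !(x.2.1 == y.2.1)) || (x.1 + 1 == y.1 && !(x.2.2 == y.2.1))

@[simp] theorem conf_nil_left (B : Item) : conf [] B = false := rfl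
@[simp] theorem conf_nil_right (A : Item) : conf A [] = false := by simp [conf]

/-- A vertex of the gadget graph. Vertices of kind `0` form the stretches, those of kind `1` and `2`
are the entries and the exits of the slots. The visit happens between the phases `lo` and `hi`. -/
structure VData where
  kind : ℕ
  st : ℕ
  lo : ℕ
  hi : ℕ
  a : Item
  b : Item

instance : TreeEnc VData := ⟨fun v => tree (v.kind, v.st, v.lo, v.hi, v.a, v.b)⟩

/-- The adjacency relation, before symmetrization. Vertices carry their index. If `link` holds, then
consecutive stretches are joined. -/
def adjHalf (link : Bool) (x y : VData × ℕ) : Bool :=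
  (x.1.kind == 0 && y.1.kind == 0 && x.2 + 1 == y.2 && (link || x.1.st == y.1.st)) ||
  (!(x.1.kind == 0) && y.1.kind == 0 && x.1.st == y.1.st) ||
  (x.1.kind == 2 && y.1.kind == 1 && x.2 + 1 == y.2) ||
  (x.1.lo == 0 && y.1.lo == 5)

def adjB (link : Bool) (x y : VData × ℕ) : Bool := adjHalf link x y || adjHalf link y x

def precB (x y : VData × ℕ) : Bool :=
  x.2 == y.2 || decide (x.1.hi < y.1.lo) ||
  (!(x.1.kind == 0) && !(y.1.kind == 0) && decide (x.2 ≤ y.2)) || conf x.1.a y.1.b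

theorem adjHalf_iff {link : Bool} {x y : VData × ℕ} : adjHalf link x y = true ↔
    (x.1.kind = 0 ∧ y.1.kind = 0 ∧ x.2 + 1 = y.2 ∧ (link = true ∨ x.1.st = y.1.st)) ∨
    (x.1.kind ≠ 0 ∧ y.1.kind = 0 ∧ x.1.st = y.1.st) ∨
    (x.1.kind = 2 ∧ y.1.kind = 1 ∧ x.2 + 1 = y.2) ∨ (x.1.lo = 0 ∧ y.1.lo = 5) := by
  simp [adjHalf, and_assoc, or_assoc]

theorem precB_iff {x y : VData × ℕ} : precB x y = true ↔
    x.2 = y.2 ∨ x.1.hi < y.1.lo ∨ (x.1.kind ≠ 0 ∧ y.1.kind ≠ 0 ∧ x.2 ≤ y.2) ∨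
      conf x.1.a y.1.b = true := by
  simp [precB, and_assoc, or_assoc]

/-- The conditions under which `precB` is a partial order. -/
structure Valid (data : List VData) : Prop where
  ne_nil : data ≠ []
  lo_le_hi : ∀ v ∈ data, v.lo ≤ v.hi
  slot : ∀ v ∈ data, v.kind ≠ 0 → v.lo = v.hi ∧ v.a = [] ∧ v.b = []
  item : ∀ v ∈ data, v.a ≠ [] ∨ v.b ≠ [] → v.lo = 1 ∧ v.hi = 4
  side : ∀ v ∈ data, v.a = [] ∨ v.b = []
  sorted : data.Pairwise fun v w => v.kind ≠ 0 → w.kind ≠ 0 → v.lo ≤ w.lo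

/-- The `i`-th vertex together with its index. -/
def vtx (data : List VData) (i : Fin data.length) : VData × ℕ := (data[i], i)

theorem vtx_mem (data : List VData) (i : Fin data.length) : (vtx data i).1 ∈ data :=
  List.getElem_mem _

theorem vtx_injective (data : List VData) : Function.Injective (vtx data) := fun _ _ h =>
  Fin.ext (congrArg Prod.snd h)

theorem Valid.lo_mono {data : List VData} (h : Valid data) {i j : Fin data.length}
    (hi : (vtx data i).1.kind ≠ 0) (hj : (vtx data j).1.kind ≠ 0)
    (hij : (vtx data i).2 ≤ (vtx data j).2) : (vtx data i).1.lo ≤ (vtx data j).1.lo := by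
  rcases hij.eq_or_lt with e | hlt
  · rw [show i = j from Fin.ext e]
  · exact List.pairwise_iff_getElem.1 h.sorted i j i.2 j.2 hlt hi hj

theorem conf_ne_nil {A B : Item} (h : conf A B = true) : A ≠ [] ∧ B ≠ [] :=
  ⟨by rintro rfl; simp at h, by rintro rfl; simp at h⟩

/-- Three relations are joined: the interval order of the phases, the chain of slot vertices, and
the conflicts. Slots are one-point intervals in sorted order, and partners of a conflict both have
the interval from 1 to 4. Hence composing the interval order with either of the others yields the
interval order again. Conflicts compose neither with the chain, as slots carry no items, nor with
each other, as no vertex carries items on both sides. -/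
theorem Valid.isPartialOrder {data : List VData} (h : Valid data) :
    IsPartialOrder (Fin data.length) fun i j => precB (vtx data i) (vtx data j) = true where
  refl i := precB_iff.2 (Or.inl rfl)
  trans i j k hij hjk := by
    rw [precB_iff] at hij hjk ⊢
    have mi := h.lo_le_hi _ (vtx_mem data i)
    have mj := h.lo_le_hi _ (vtx_mem data j)
    have wj := h.slot _ (vtx_mem data j)
    have ij := h.item _ (vtx_mem data j)
    have ik := h.item _ (vtx_mem data k)
    have ii := h.item _ (vtx_mem data i)
    have sj := h.side _ (vtx_mem data j)
    rcases hij with e | hij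
    · rwa [show i = j from Fin.ext e]
    rcases hjk with e | hjk
    · rw [← show j = k from Fin.ext e]; exact Or.inr hij
    right
    rcases hij with h1 | h1 | h1 <;> rcases hjk with h2 | h2 | h2
    · exact Or.inl (by omega)
    · have := h.lo_mono h2.1 h2.2.1 h2.2.2
      exact Or.inl (by omega)
    · have e1 := ij (Or.inl (conf_ne_nil h2).1)
      have e2 := ik (Or.inr (conf_ne_nil h2).2)
      exact Or.inl (by omega)
    · have := h.lo_mono h1.1 h1.2.1 h1.2.2
      have := h.slot _ (vtx_mem data i) h1.1
      have := wj h1.2.1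
      exact Or.inl (by omega)
    · exact Or.inr (Or.inl ⟨h1.1, h2.2.1, h1.2.2.trans h2.2.2⟩)
    · exact absurd (wj h1.2.1).2.1 (conf_ne_nil h2).1
    · have e1 := ij (Or.inr (conf_ne_nil h1).2)
      have e2 := ii (Or.inl (conf_ne_nil h1).1)
      exact Or.inl (by omega)
    · exact absurd (wj h2.1).2.2 (conf_ne_nil h1).2
    · rcases sj with e | e
      · exact absurd e (conf_ne_nil h2).1
      · exact absurd e (conf_ne_nil h1).2
  antisymm i j hij hji := by
    rw [precB_iff] at hij hji
    have mi := h.lo_le_hi _ (vtx_mem data i)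
    have mj := h.lo_le_hi _ (vtx_mem data j)
    have wj := h.slot _ (vtx_mem data j)
    have wi := h.slot _ (vtx_mem data i)
    have ij := h.item _ (vtx_mem data j)
    have ii := h.item _ (vtx_mem data i)
    have sj := h.side _ (vtx_mem data j)
    rcases hij with e | hij
    · exact Fin.ext e
    rcases hji with e | hji
    · exact Fin.ext e.symm
    rcases hij with h1 | h1 | h1 <;> rcases hji with h2 | h2 | h2
    · omega
    · have := h.lo_mono h2.1 h2.2.1 h2.2.2
      omega
    · have e1 := ij (Or.inl (conf_ne_nil h2).1)
      have e2 := ii (Or.inr (conf_ne_nil h2).2)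
      omega
    · have := h.lo_mono h1.1 h1.2.1 h1.2.2
      omega
    · exact Fin.ext (le_antisymm h1.2.2 h2.2.2)
    · exact absurd (wj h1.2.1).2.1 (conf_ne_nil h2).1
    · have e1 := ij (Or.inr (conf_ne_nil h1).2)
      have e2 := ii (Or.inl (conf_ne_nil h1).1)
      omega
    · exact absurd (wj h2.1).2.2 (conf_ne_nil h1).2
    · rcases sj with e | e
      · exact absurd e (conf_ne_nil h2).1
      · exact absurd e (conf_ne_nil h1).2

/-- The graph on the indices of `data`. -/
def dataGraph (link : Bool) (data : List VData) : SimpleGraph (Fin data.length) where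
  Adj i j := adjB link (vtx data i) (vtx data j) = true
  symm := ⟨fun i j hij => by simpa [adjB, or_comm] using hij⟩
  loopless := ⟨fun i hi => by
    rw [adjB, Bool.or_self, adjHalf_iff] at hi
    rcases hi with hi | hi | hi | hi <;> omega⟩

/-- The ordered graph on the indices of `data`. -/
def orderedGraph (link : Bool) (data : List VData) (h : Valid data) : OrderedGraph where
  n := data.length
  pos := List.length_pos_iff.2 h.ne_nil
  G := dataGraph link data
  prec i j := precB (vtx data i) (vtx data j) = true
  isPartialOrder := h.isPartialOrder

/-! ### The stretches and the slots -/

/-- The two ends of the stretch `st`; `sd` tells on which side of the conflicts it is. -/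
def endV (sd : Bool) (st : ℕ) : VData :=
  if sd then ⟨0, st, 3, 4, [], []⟩ else ⟨0, st, 1, 2, [], []⟩

/-- The phases 1 to 4 leave an item free to be visited in any slot of its stretch. The side decides
whether it is the earlier or the later partner of its conflicts. -/
def itemV (sd : Bool) (st : ℕ) (T : Item) : VData :=
  if sd then ⟨0, st, 1, 4, [], T⟩ else ⟨0, st, 1, 4, T, []⟩

def inV (s : ℕ × ℕ) : VData := ⟨1, s.1, s.2, s.2, [], []⟩
def outV (s : ℕ × ℕ) : VData := ⟨2, s.1, s.2, s.2, [], []⟩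

/-- Numbered stretches. -/
def stretches (S : List (Bool × List Item)) : List ((Bool × List Item) × ℕ) := S.zipIdx 1

def chunk (X : (Bool × List Item) × ℕ) : List VData :=
  endV X.1.1 X.2 :: X.1.2.map (itemV X.1.1 X.2) ++ [endV X.1.1 X.2]

def pathData (S : List (Bool × List Item)) : List VData := (stretches S).flatMap chunk

/-- In each round, the stretches on one side are visited once; the second number is the phase. -/
def rounds : List (Bool × ℕ) :=
  [(false, 1), (false, 1), (true, 2), (false, 3), (true, 4), (true, 4)]

def slots (S : List (Bool × List Item)) : List (ℕ × ℕ) :=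
  rounds.flatMap fun r => ((stretches S).filter fun X => X.1.1 == r.1).map fun X => (X.2, r.2)

/-- Stretches are numbered from 1, so the two vertices with stretch number 0 see no stretch. Their
phases 0 and 5 force them to be the first and the last vertex of an ordered Hamiltonian path. -/
def slotData (S : List (Bool × List Item)) : List VData :=
  outV (0, 0) :: (slots S).flatMap (fun s => [inV s, outV s]) ++ [inV (0, 5)]

def gadget (S : List (Bool × List Item)) : List VData := pathData S ++ slotData S

/-- Items can be selected in all stretches without any conflict. -/
def Selectable (S : List (Bool × List Item)) : Prop :=
  ∃ P : Bool → Item → Prop, (∀ X ∈ S, ∃ T ∈ X.2, P X.1 T) ∧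
    ∀ T T', P false T → P true T' → conf T T' = false

section
variable {S : List (Bool × List Item)}

theorem stretches_injOn {X Y : (Bool × List Item) × ℕ} (hX : X ∈ stretches S)
    (hY : Y ∈ stretches S) (h : X.2 = Y.2) : X = Y := by
  refine List.inj_on_of_nodup_map (f := Prod.snd) ?_ hX hY h
  rw [stretches, List.zipIdx_map_snd]
  exact List.nodup_range'

theorem one_le_of_mem_stretches {X : (Bool × List Item) × ℕ} (hX : X ∈ stretches S) : 1 ≤ X.2 :=
  (List.mem_zipIdx hX).1

theorem mem_pathData {v : VData} : v ∈ pathData S ↔ ∃ X ∈ stretches S,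
    v = endV X.1.1 X.2 ∨ ∃ T ∈ X.1.2, v = itemV X.1.1 X.2 T := by
  simp only [pathData, chunk, List.mem_flatMap, List.mem_append, List.mem_cons, List.mem_map,
    List.not_mem_nil, or_false]
  refine exists_congr fun X => and_congr_right fun _ => ⟨?_, ?_⟩
  · rintro ((h | ⟨T, hT, h⟩) | h)
    exacts [.inl h, .inr ⟨T, hT, h.symm⟩, .inl h]
  · rintro (h | ⟨T, hT, h⟩)
    exacts [.inr h, .inl (.inr ⟨T, hT, h.symm⟩)]

theorem mem_slots {s : ℕ × ℕ} : s ∈ slots S ↔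
    ∃ X ∈ stretches S, s.1 = X.2 ∧ (X.1.1, s.2) ∈ rounds := by
  obtain ⟨i, p⟩ := s
  simp only [slots, List.mem_flatMap, List.mem_map, List.mem_filter, beq_iff_eq, Prod.mk.injEq,
    Prod.exists]
  constructor
  · rintro ⟨sd, ph, hr, x, y, j, ⟨hX, rfl⟩, rfl, rfl⟩
    exact ⟨x, y, j, hX, rfl, hr⟩
  · rintro ⟨x, y, j, hX, rfl, hr⟩
    exact ⟨_, _, hr, x, y, _, ⟨hX, rfl⟩, rfl, rfl⟩

theorem phase_of_mem_slots {s : ℕ × ℕ} (h : s ∈ slots S) : 1 ≤ s.1 ∧ 1 ≤ s.2 ∧ s.2 ≤ 4 := by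
  obtain ⟨X, hX, h1, h2⟩ := mem_slots.1 h
  have := one_le_of_mem_stretches hX
  refine ⟨by omega, ?_⟩
  simp only [rounds, List.mem_cons, Prod.mk.injEq, List.not_mem_nil,
    or_false] at h2
  rcases h2 with h | h | h | h | h | h <;> omega

theorem slots_sorted : (slots S).Pairwise fun s s' => s.2 ≤ s'.2 := by
  have hr : rounds.Pairwise fun r r' => r.2 ≤ r'.2 := by simp [rounds]
  rw [slots, List.pairwise_flatMap]
  refine ⟨fun r _ => ?_, hr.imp fun {r r'} h s hs s' hs' => ?_⟩
  · rw [List.pairwise_map]; exact List.pairwise_of_forall fun _ _ => le_rfl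
  · obtain ⟨_, _, rfl⟩ := List.mem_map.1 hs
    obtain ⟨_, _, rfl⟩ := List.mem_map.1 hs'
    exact h

theorem mem_slotData {v : VData} : v ∈ slotData S ↔ v = outV (0, 0) ∨ v = inV (0, 5) ∨
    ∃ s ∈ slots S, v = inV s ∨ v = outV s := by
  simp only [slotData, List.mem_append, List.mem_cons, List.mem_flatMap, List.not_mem_nil,
    or_false]
  rw [or_assoc]
  exact or_congr_right or_comm

theorem kind_of_mem_pathData {v : VData} (h : v ∈ pathData S) : v.kind = 0 := by
  obtain ⟨X, -, rfl | ⟨T, -, rfl⟩⟩ := mem_pathData.1 h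
  · unfold endV; split <;> rfl
  · unfold itemV; split <;> rfl

theorem kind_of_mem_slotData {v : VData} (h : v ∈ slotData S) : v.kind ≠ 0 := by
  obtain rfl | rfl | ⟨s, -, rfl | rfl⟩ := mem_slotData.1 h <;> simp [inV, outV]

theorem valid_gadget : Valid (gadget S) where
  ne_nil := by simp [gadget, slotData]
  lo_le_hi v hv := by
    rcases List.mem_append.1 hv with hv | hv
    · obtain ⟨X, -, rfl | ⟨T, -, rfl⟩⟩ := mem_pathData.1 hv
      · unfold endV; split <;> simp
      · unfold itemV; split <;> simp
    · obtain rfl | rfl | ⟨s, -, rfl | rfl⟩ := mem_slotData.1 hv <;> simp [inV, outV]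
  slot v hv hk := by
    rcases List.mem_append.1 hv with hv | hv
    · exact absurd (kind_of_mem_pathData hv) hk
    · obtain rfl | rfl | ⟨s, -, rfl | rfl⟩ := mem_slotData.1 hv <;> simp [inV, outV]
  item v hv := by
    rcases List.mem_append.1 hv with hv | hv
    · obtain ⟨X, -, rfl | ⟨T, -, rfl⟩⟩ := mem_pathData.1 hv
      · unfold endV; split <;> simp
      · unfold itemV; split <;> simp
    · obtain rfl | rfl | ⟨s, -, rfl | rfl⟩ := mem_slotData.1 hv <;> simp [inV, outV]
  side v hv := by
    rcases List.mem_append.1 hv with hv | hv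
    · obtain ⟨X, -, rfl | ⟨T, -, rfl⟩⟩ := mem_pathData.1 hv
      · unfold endV; split <;> simp
      · unfold itemV; split <;> simp
    · obtain rfl | rfl | ⟨s, -, rfl | rfl⟩ := mem_slotData.1 hv <;> simp [inV, outV]
  sorted := by
    rw [gadget, List.pairwise_append]
    refine ⟨?_, ?_, fun v hv w _ hk => absurd (kind_of_mem_pathData hv) hk⟩
    · exact List.pairwise_iff_getElem.2 fun i j hi hj _ hk =>
        absurd (kind_of_mem_pathData (List.getElem_mem hi)) hk
    · rw [slotData, List.pairwise_append, List.pairwise_cons]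
      refine ⟨⟨fun v _ => by simp [outV], ?_⟩, by simp, fun v hv w hw _ _ => ?_⟩
      · rw [List.pairwise_flatMap]
        refine ⟨fun s _ => by simp [inV, outV], slots_sorted.imp fun {s s'} h v hv w hw _ _ => ?_⟩
        simp only [List.mem_cons, List.not_mem_nil, or_false] at hv hw
        rcases hv with rfl | rfl <;> rcases hw with rfl | rfl <;> exact h
      · obtain rfl := List.mem_singleton.1 hw
        rcases List.mem_cons.1 hv with rfl | hv
        · simp [inV, outV]
        · obtain ⟨s, hs, hv⟩ := List.mem_flatMap.1 hv
          have := phase_of_mem_slots hs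
          simp only [List.mem_cons, List.not_mem_nil, or_false] at hv
          rcases hv with rfl | rfl <;> simp only [inV, outV] <;> omega

end
end POH

namespace POH

/-! ### From an ordered Hamiltonian path to a selection -/

/-- The positions of the vertices on an ordered Hamiltonian path. -/
theorem OrderedGraph.HasHamPath.exists_position {I : OrderedGraph} (h : I.HasHamPath) :
    ∃ pos : Fin I.n → ℕ, Function.Injective pos ∧ (∀ u v, I.prec u v → pos u ≤ pos v) ∧
      ∀ u v, pos u < pos v → ∃ z, pos z = pos u + 1 ∧ I.G.Adj u z := by
  obtain ⟨a, b, p, hp, hext⟩ := h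
  have hpos : ∀ v, ∃ i, p.getVert i = v ∧ i ≤ p.length := fun v =>
    SimpleGraph.Walk.mem_support_iff_exists_getVert.1 (hp.mem_support v)
  choose pos hget hle using hpos
  refine ⟨pos, fun u v huv => by rw [← hget u, huv, hget v], fun u v huv =>
    hext _ _ (hle u) (hle v) (by rwa [hget, hget]), fun u v huv => ?_⟩
  have hlt : pos u < p.length := lt_of_lt_of_le huv (hle v)
  refine ⟨p.getVert (pos u + 1), ?_, ?_⟩
  · exact hp.isPath.getVert_injOn (hle _) (show pos u + 1 ≤ p.length by omega) (hget _)
  · have := p.adj_getVert_succ hlt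
    rwa [hget] at this

/-- The phase in which the selected item is visited. -/
def selPhase (sd : Bool) : ℕ := if sd then 2 else 3

variable {S : List (Bool × List Item)} {link : Bool}

theorem mem_slots_selPhase {X : (Bool × List Item) × ℕ} (hX : X ∈ stretches S) :
    (X.2, selPhase X.1.1) ∈ slots S :=
  mem_slots.2 ⟨X, hX, rfl, by cases h : X.1.1 <;> simp [selPhase, rounds]⟩

/-- The final vertex `t` is included because it shows that the entry `i` is not the end of a
Hamiltonian path. -/
theorem exists_inV_outV {s : ℕ × ℕ} (hs : s ∈ slots S) :
    ∃ (i j t : Fin (gadget S).length), (gadget S)[i] = inV s ∧ (gadget S)[j] = outV s ∧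
      (gadget S)[t] = inV (0, 5) ∧ (i : ℕ) < j ∧ (i : ℕ) < t := by
  obtain ⟨l, r, hlr⟩ := List.mem_iff_append.1 hs
  have e : gadget S = (pathData S ++ outV (0, 0) :: l.flatMap fun s => [inV s, outV s]) ++
      (inV s :: outV s :: (r.flatMap fun s => [inV s, outV s]) ++ [inV (0, 5)]) := by
    simp [gadget, slotData, hlr]
  generalize (pathData S ++ outV (0, 0) :: l.flatMap fun s => [inV s, outV s]) = A at e
  generalize (r.flatMap fun s => [inV s, outV s]) = B at e
  suffices key : ∀ D : List VData, D = A ++ (inV s :: outV s :: B ++ [inV (0, 5)]) →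
      ∃ (i j t : Fin D.length), D[i] = inV s ∧ D[j] = outV s ∧ D[t] = inV (0, 5) ∧
        (i : ℕ) < j ∧ (i : ℕ) < t from key _ e
  rintro _ rfl
  refine ⟨⟨A.length, by simp⟩, ⟨A.length + 1, by simp⟩, ⟨A.length + B.length + 2, by simp; omega⟩,
    ?_, ?_, ?_, by simp, by simp; omega⟩
  · simp
  · simp [List.getElem_append_right]
  · simp [List.getElem_append_right, add_assoc]

theorem selectable_of_hasHamPath
    (h : (orderedGraph link (gadget S) valid_gadget).HasHamPath) : Selectable S := by
  obtain ⟨pos, hinj, hprec, hnext⟩ := h.exists_position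
  change ∀ u v, precB (vtx (gadget S) u) (vtx (gadget S) v) = true → _ at hprec
  change ∀ u v, _ → ∃ z, _ ∧ adjB link (vtx (gadget S) u) (vtx (gadget S) z) = true at hnext
  replace hprec := fun u v huv => hprec u v (precB_iff.2 huv)
  simp only [vtx] at hprec
  -- An item counts as selected if it directly follows the entry of a slot of its stretch in phase 2
  -- (side `true`) or 3 (side `false`).
  refine ⟨fun sd T => ∃ (st : ℕ) (i z : Fin (gadget S).length), (gadget S)[i] = inV (st, selPhase sd) ∧
    (gadget S)[z] = itemV sd st T ∧ pos z = pos i + 1, fun X hX => ?_, ?_⟩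
  · obtain ⟨n, hn⟩ : ∃ n, (X, n) ∈ stretches S := by
      obtain ⟨n, hn, rfl⟩ := List.mem_iff_getElem.1 hX
      exact ⟨n + 1, List.mk_mem_zipIdx_iff_le_and_getElem?_sub.2 (by simp [hn])⟩
    have hslot := mem_slots_selPhase hn
    obtain ⟨i, j, t, hi, hj, ht, hij, hit⟩ := exists_inV_outV hslot
    simp only at hi hj
    have hlt : pos i < pos t := lt_of_le_of_ne
      (hprec i t (.inr (.inr (.inl (by simp only [hi, ht, inV]; omega)))))
      fun e => by have := congrArg Fin.val (hinj e); omega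
    have hlt' : pos i < pos j := lt_of_le_of_ne
      (hprec i j (.inr (.inr (.inl (by simp only [hi, hj, inV, outV]; omega)))))
      fun e => by have := congrArg Fin.val (hinj e); omega
    obtain ⟨z, hz, hadj⟩ := hnext i t hlt
    rw [adjB, Bool.or_eq_true, adjHalf_iff, adjHalf_iff] at hadj
    simp only [vtx, hi, inV] at hadj
    have hph : selPhase X.1 = 2 ∨ selPhase X.1 = 3 := by
      unfold selPhase; split <;> simp
    -- Apart from its stretch, the entry is adjacent only to the exit just before it, which the
    -- order has already placed earlier on the path.
    have hkst : (gadget S)[z].kind = 0 ∧ n = (gadget S)[z].st := by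
      rcases hadj with (h | h | h | h) | (h | h | h | h)
      · omega
      · exact h.2
      · omega
      · omega
      · omega
      · omega
      · have := hprec z i (.inr (.inr (.inl (by simp only [hi, inV]; omega))))
        omega
      · omega
    have hmem : (gadget S)[z] ∈ pathData S := by
      rcases List.mem_append.1 (List.getElem_mem z.2) with h | h
      · exact h
      · exact absurd hkst.1 (kind_of_mem_slotData h)
    obtain ⟨Y, hY, hzY⟩ := mem_pathData.1 hmem
    have hst : n = Y.2 := by
      rw [hkst.2]
      obtain h | ⟨T, -, h⟩ := hzY
      · rw [h]; unfold endV; split <;> rfl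
      · rw [h]; unfold itemV; split <;> rfl
    obtain rfl : (X, n) = Y := stretches_injOn hn hY hst
    obtain h | ⟨T, hT, h⟩ := hzY
    -- The successor of the entry cannot be an end of the stretch. On side `false`, ends must
    -- precede phase 3. On side `true`, they must come after the exit of phase 2, which would have
    -- to lie strictly between the entry and its successor.
    · exfalso
      cases hsd : X.1 with
      | false =>
        have := hprec z i (.inr (.inl (by simp [h, hi, endV, inV, hsd, selPhase])))
        omega
      | true =>
        have h1 := hprec j z (.inr (.inl (by simp [h, hj, endV, outV, hsd, selPhase])))
        have h2 : j = z := hinj (by omega)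
        rw [h2, h] at hj
        simp [hsd, endV, outV] at hj
    · exact ⟨T, hT, n, i, z, hi, h, hz⟩
  -- A conflict would put the item entered in phase 3 before the one entered in phase 2, contrary to
  -- the order of their entries.
  · rintro T T' ⟨st, i, z, hi, hz, hp⟩ ⟨st', i', z', hi', hz', hp'⟩
    by_contra hc
    have h1 := hprec z z' (.inr (.inr (.inr (by simpa [hz, hz', itemV] using hc))))
    have h2 := hprec i' i (.inr (.inl (by simp [hi, hi', inV, selPhase])))
    have h3 : i = i' := hinj (by omega)
    rw [h3, hi'] at hi
    simp [inV, selPhase] at hi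

end POH

namespace POH

/-! ### From a selection to an ordered Hamiltonian cycle -/

theorem map_vtx_finRange (data : List VData) :
    (List.finRange data.length).map (vtx data) = data.zipIdx := by
  apply List.ext_getElem
  · simp
  · intro i h1 h2
    simp [vtx]

/-- A suitable enumeration of the vertices is an ordered Hamiltonian cycle. -/
theorem OrderedGraph.hasHamCycle_of_list (I : OrderedGraph) {L : List (Fin I.n)}
    (hperm : L.Perm (List.finRange I.n)) (hchain : L.IsChain I.G.Adj)
    (hprec : L.Pairwise fun u v => ¬ I.prec v u) (hne : L ≠ [])
    (hadj : I.G.Adj (L.head hne) (L.getLast hne)) : I.HasHamCycle := by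
  let p := SimpleGraph.Walk.ofSupport L hne hchain
  have hsupp : p.support = L := SimpleGraph.Walk.support_ofSupport hne hchain
  refine ⟨_, _, p, fun v => ?_, hadj, fun i j hi hj hij => ?_⟩
  · rw [hsupp, hperm.count_eq]
    exact List.count_eq_one_of_mem (List.nodup_finRange _) (List.mem_finRange _)
  · by_contra hlt
    have hi' : i < L.length := by rw [← hsupp, SimpleGraph.Walk.length_support]; omega
    have hj' : j < L.length := by omega
    have := List.pairwise_iff_getElem.1 hprec j i hj' hi' (by omega)
    rw [p.getVert_eq_support_getElem hi, p.getVert_eq_support_getElem hj] at hij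
    simp only [hsupp] at hij
    exact this hij

theorem hasHamCycle_of_vertexList {link : Bool} {data : List VData} (hv : Valid data)
    {x y : VData × ℕ} {M : List (VData × ℕ)} (hperm : (x :: (M ++ [y])).Perm data.zipIdx)
    (hchain : (x :: (M ++ [y])).IsChain fun u v => adjB link u v = true)
    (hprec : (x :: (M ++ [y])).Pairwise fun u v => precB v u = false)
    (hxy : adjB link x y = true) : (orderedGraph link data hv).HasHamCycle := by
  obtain ⟨L, hL⟩ : x :: (M ++ [y]) ∈ Set.range (List.map (vtx data)) := by
    rw [Set.range_list_map]
    intro v hv'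
    have := hperm.subset hv'
    rw [← map_vtx_finRange, List.mem_map] at this
    obtain ⟨i, -, rfl⟩ := this
    exact ⟨i, rfl⟩
  rw [← hL] at hperm hchain hprec
  rw [← map_vtx_finRange, List.map_perm_map_iff (vtx_injective data)] at hperm
  rw [List.isChain_map] at hchain
  rw [List.pairwise_map] at hprec
  have hne : L ≠ [] := by rintro rfl; simp at hL
  have hne' : L.map (vtx data) ≠ [] := by simpa using hne
  have hhead : vtx data (L.head hne) = x := by
    rw [← List.head_map hne']
    simp only [hL, List.head_cons]
  have hlast : vtx data (L.getLast hne) = y := by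
    rw [← List.getLast_map hne']
    simp only [hL]
    simp
  refine (orderedGraph link data hv).hasHamCycle_of_list (L := L) hperm hchain
    (hprec.imp fun {u v} h h' => ?_) hne ?_
  · exact absurd (show precB _ _ = true from h') (by rw [h]; simp)
  · exact show adjB link (vtx data (L.head hne)) (vtx data (L.getLast hne)) = true by
      rwa [hhead, hlast]

/-- Equal labels may occur at several indices. This cuts the list of indexed vertices itself along
the stretches. -/
theorem exists_blocks {α β γ : Type} (g : α → β) (f : γ → List β) :
    ∀ (X : List γ) (l : List α), l.map g = X.flatMap f →
      ∃ h : List (γ × List α), l = h.flatMap Prod.snd ∧ h.map Prod.fst = X ∧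
        ∀ p ∈ h, p.2.map g = f p.1
  | [], l, hl => ⟨[], by simpa using hl, rfl, by simp⟩
  | x :: X, l, hl => by
    rw [List.flatMap_cons, List.map_eq_append_iff] at hl
    obtain ⟨l₁, l₂, rfl, h1, h2⟩ := hl
    obtain ⟨h, rfl, h3, h4⟩ := exists_blocks g f X l₂ h2
    exact ⟨(x, l₁) :: h, by simp, by simp [h3], by simpa [h1] using fun a b hb => h4 (a, b) hb⟩

/-- Insert the segments between the entries and exits of the slots. -/
def weave : List ((ℕ × ℕ) × List (VData × ℕ)) → List (VData × ℕ) → List (VData × ℕ)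
  | s :: segs, i :: o :: w => i :: (s.2 ++ o :: weave segs w)
  | _, w => w

/-- The list `w` consists of an entry and an exit for every segment, and of the final vertex. -/
def Frames (segs : List ((ℕ × ℕ) × List (VData × ℕ))) (w : List (VData × ℕ)) : Prop :=
  w.map Prod.fst = segs.flatMap (fun s => [inV s.1, outV s.1]) ++ [inV (0, 5)]

theorem Frames.cases {s : (ℕ × ℕ) × List (VData × ℕ)} {segs : List ((ℕ × ℕ) × List (VData × ℕ))}
    {w : List (VData × ℕ)} (h : Frames (s :: segs) w) :
    ∃ i o w', w = (inV s.1, i) :: (outV s.1, o) :: w' ∧ Frames segs w' := by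
  rw [Frames, List.flatMap_cons, List.append_assoc, List.cons_append, List.cons_append,
    List.map_eq_cons_iff] at h
  obtain ⟨⟨_, i⟩, w1, rfl, rfl, h⟩ := h
  rw [List.map_eq_cons_iff] at h
  obtain ⟨⟨_, o⟩, w2, rfl, rfl, h⟩ := h
  exact ⟨i, o, w2, rfl, h⟩

theorem Frames.nil {w : List (VData × ℕ)} (h : Frames [] w) : ∃ t, w = [(inV (0, 5), t)] := by
  rw [Frames, List.flatMap_nil, List.nil_append, List.map_eq_singleton_iff] at h
  obtain ⟨⟨_, t⟩, rfl, rfl⟩ := h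
  exact ⟨t, rfl⟩

/-- The elements before `y` on the path may be `x`, as far as the labels are concerned. -/
def Before (x y : VData × ℕ) : Prop :=
  x.1.lo ≤ y.1.hi ∧ (x.1.kind = 0 ∨ y.1.kind = 0 ∨ x.2 < y.2) ∧ conf y.1.a x.1.b = false

theorem precB_eq_false {x y : VData × ℕ} (h : Before x y) (hne : x ≠ y)
    (hidx : x.2 = y.2 → x = y) : precB y x = false := by
  rw [← Bool.not_eq_true, precB_iff]
  rintro (h1 | h1 | h1 | h1)
  · exact hne (hidx h1.symm)
  · have := h.1; omega
  · have := h.2.1; omega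
  · rw [h.2.2] at h1; exact absurd h1 (by simp)

/-- A segment that may be visited in its slot. -/
structure SegmentOK (P : Bool → Item → Prop) (s : (ℕ × ℕ) × List (VData × ℕ)) : Prop where
  ne_nil : s.2 ≠ []
  chain : s.2.IsChain fun u v => u.2 + 1 = v.2
  label : ∀ x ∈ s.2, x.1.kind = 0 ∧ x.1.st = s.1.1 ∧ x.1.lo ≤ s.1.2 ∧ s.1.2 ≤ x.1.hi
  side : ((∀ x ∈ s.2, x.1.b = []) ∧ (s.1.2 = 1 ∨ s.1.2 = 3 ∧ ∀ x ∈ s.2, P false x.1.a)) ∨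
    ((∀ x ∈ s.2, x.1.a = []) ∧ (s.1.2 = 4 ∨ s.1.2 = 2 ∧ ∀ x ∈ s.2, P true x.1.b))

section
variable {P : Bool → Item → Prop} {segs : List ((ℕ × ℕ) × List (VData × ℕ))}
  {w : List (VData × ℕ)} {link : Bool}

theorem weave_perm (hw : Frames segs w) : (weave segs w).Perm (segs.flatMap Prod.snd ++ w) := by
  induction segs generalizing w with
  | nil => obtain ⟨t, rfl⟩ := hw.nil; simp [weave]
  | cons s segs ih =>
    obtain ⟨i, o, w, rfl, hf⟩ := hw.cases
    rw [weave, List.flatMap_cons, List.append_assoc]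
    refine List.Perm.trans (List.Perm.cons _ (List.perm_middle.trans
      (List.Perm.cons _ ((ih hf).append_left s.2)))) ?_
    rw [← List.append_assoc, ← List.append_assoc]
    exact (List.perm_append_comm_assoc [(inV s.1, i), (outV s.1, o)]
      (s.2 ++ segs.flatMap Prod.snd) w)

theorem weave_last (hw : Frames segs w) : ∃ M t, weave segs w = M ++ [(inV (0, 5), t)] := by
  induction segs generalizing w with
  | nil => obtain ⟨t, rfl⟩ := hw.nil; exact ⟨[], t, by simp [weave]⟩
  | cons s segs ih =>
    obtain ⟨i, o, w, rfl, hf⟩ := hw.cases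
    obtain ⟨M, t, h⟩ := ih hf
    exact ⟨(inV s.1, i) :: (s.2 ++ (outV s.1, o) :: M), t, by simp [weave, h]⟩

/-- The exit `p` in front of the list is needed for the induction: consecutive indices of slot
vertices supply the edge from each exit to the next entry. Within a slot, the frame is adjacent to
every vertex of the segment. -/
theorem weave_chain (hs : ∀ s ∈ segs, SegmentOK P s) (hw : Frames segs w) {p : VData × ℕ}
    (hp : p.1.kind = 2) (hc : (p :: w).IsChain fun u v => u.2 + 1 = v.2) :
    (p :: weave segs w).IsChain fun u v => adjB link u v = true := by
  induction segs generalizing w p with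
  | nil =>
    obtain ⟨t, rfl⟩ := hw.nil
    simp only [List.isChain_cons_cons, List.isChain_singleton, and_true] at hc
    simp only [weave, List.isChain_cons_cons, List.isChain_singleton, and_true]
    rw [adjB, Bool.or_eq_true, adjHalf_iff]
    exact Or.inl (.inr (.inr (.inl ⟨hp, rfl, hc⟩)))
  | cons s segs ih =>
    obtain ⟨i, o, w, rfl, hf⟩ := hw.cases
    rw [List.isChain_cons_cons, List.isChain_cons_cons] at hc
    have hS := hs s List.mem_cons_self
    have htail := ih (fun s hs' => hs s (List.mem_cons_of_mem _ hs')) hf (p := (outV s.1, o)) rfl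
      hc.2.2
    rw [weave, List.isChain_cons_cons]
    refine ⟨by
      rw [adjB, Bool.or_eq_true, adjHalf_iff]
      exact Or.inl (.inr (.inr (.inl ⟨hp, rfl, hc.1⟩))), ?_⟩
    have hframe : ∀ v : VData × ℕ, v.1 = inV s.1 ∨ v.1 = outV s.1 → ∀ x ∈ s.2,
        adjHalf link v x = true := fun v hv x hx => by
      have hx' := hS.label x hx
      rw [adjHalf_iff]
      refine .inr (.inl ?_)
      rcases hv with hv | hv <;> rw [hv] <;> simp [inV, outV, hx'.1, hx'.2.1]
    rw [← List.cons_append]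
    refine List.isChain_append.2 ⟨List.isChain_cons.2 ⟨fun x hx => ?_, ?_⟩, htail, ?_⟩
    · rw [adjB, hframe _ (Or.inl rfl) x (List.mem_of_mem_head? hx), Bool.true_or]
    · refine List.IsChain.imp_of_mem_imp ?_ hS.chain
      intro x y hx hy hxy
      have hx' := hS.label x hx
      have hy' := hS.label y hy
      rw [adjB, Bool.or_eq_true, adjHalf_iff]
      exact Or.inl (.inl ⟨hx'.1, hy'.1, hxy, .inr (by rw [hx'.2.1, hy'.2.1])⟩)
    · intro x hx y hy
      simp only [List.head?_cons, Option.mem_def, Option.some.injEq] at hy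
      subst hy
      have hx2 : x ∈ s.2 := by
        obtain ⟨a, l, e⟩ := List.exists_cons_of_ne_nil hS.ne_nil
        rw [e, List.getLast?_cons_cons] at hx
        rw [e]
        exact List.mem_of_getLast? hx
      rw [adjB, hframe _ (Or.inr rfl) x hx2, Bool.or_true]

/-- Only a `true` vertex `x` followed by a `false` vertex `y` could violate a conflict. Phases 2 and
4 on side `true` and 1 and 3 on side `false` allow this only for phase 2 followed by phase 3, where
both items are selected. -/
theorem before_of_segmentOK (hP : ∀ T T', P false T → P true T' → conf T T' = false)
    {s s' : (ℕ × ℕ) × List (VData × ℕ)} (hs : SegmentOK P s) (hs' : SegmentOK P s')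
    (h : s.1.2 ≤ s'.1.2) {x y : VData × ℕ} (hx : x ∈ s.2) (hy : y ∈ s'.2) : Before x y := by
  have hx' := hs.label x hx
  have hy' := hs'.label y hy
  refine ⟨by omega, .inl hx'.1, ?_⟩
  rcases hs.side with h1 | h1
  · rw [h1.1 x hx, conf_nil_right]
  rcases hs'.side with h2 | h2
  · rcases h1.2 with h1 | h1
    · omega
    rcases h2.2 with h2 | h2
    · omega
    exact hP _ _ (h2.2 y hy) (h1.2 x hx)
  · rw [h2.1 y hy, conf_nil_left]

/-- The second half strengthens the induction: it bounds the phases of everything still to come and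
records where each vertex originates. The restriction `m ≤ 5` is due to the final vertex. -/
theorem weave_before (hP : ∀ T T', P false T → P true T' → conf T T' = false)
    (hs : ∀ s ∈ segs, SegmentOK P s) (hsort : segs.Pairwise fun s s' => s.1.2 ≤ s'.1.2)
    (hph : ∀ s ∈ segs, s.1.2 ≤ 5) (hw : Frames segs w) (hc : w.Pairwise fun u v => u.2 < v.2) :
    (weave segs w).Pairwise Before ∧
      ∀ m ≤ 5, (∀ s ∈ segs, m ≤ s.1.2) → ∀ y ∈ weave segs w, m ≤ y.1.hi ∧
        (y ∈ w ∧ y.1.a = [] ∨ ∃ s ∈ segs, y ∈ s.2) := by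
  induction segs generalizing w with
  | nil => obtain ⟨t, rfl⟩ := hw.nil; simp [weave, inV]
  | cons s segs ih =>
    obtain ⟨i, o, w, rfl, hf⟩ := hw.cases
    rw [List.pairwise_cons, List.pairwise_cons] at hc
    rw [List.pairwise_cons] at hsort
    have hS := hs s List.mem_cons_self
    have hsph := hph s List.mem_cons_self
    obtain ⟨h1, h2⟩ := ih (fun s hs' => hs s (List.mem_cons_of_mem _ hs')) hsort.2
      (fun s hs' => hph s (List.mem_cons_of_mem _ hs')) hf hc.2.2
    have h3 := h2 s.1.2 hsph hsort.1
    constructor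
    · rw [weave, List.pairwise_cons, List.pairwise_append, List.pairwise_cons]
      refine ⟨fun y hy => ?_, List.pairwise_iff_getElem.2 fun a b ha hb _ =>
        before_of_segmentOK hP hS hS le_rfl (List.getElem_mem ha) (List.getElem_mem hb),
        ⟨fun y hy => ?_, h1⟩, fun x hx y hy => ?_⟩
      · rcases List.mem_append.1 hy with hy | hy
        · have := hS.label y hy
          exact ⟨this.2.2.2, .inr (.inl this.1), conf_nil_right _⟩
        rcases List.mem_cons.1 hy with rfl | hy
        · exact ⟨le_rfl, .inr (.inr (hc.1 _ List.mem_cons_self)), conf_nil_right _⟩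
        · refine ⟨(h3 y hy).1, ?_, conf_nil_right _⟩
          rcases (h3 y hy).2 with h | ⟨s', hs', hy'⟩
          · exact .inr (.inr (hc.1 _ (List.mem_cons_of_mem _ h.1)))
          · exact .inr (.inl ((hs s' (List.mem_cons_of_mem _ hs')).label y hy').1)
      · refine ⟨(h3 y hy).1, ?_, conf_nil_right _⟩
        rcases (h3 y hy).2 with h | ⟨s', hs', hy'⟩
        · exact .inr (.inr (hc.2.1 _ h.1))
        · exact .inr (.inl ((hs s' (List.mem_cons_of_mem _ hs')).label y hy').1)
      · have hx' := hS.label x hx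
        rcases List.mem_cons.1 hy with rfl | hy
        · exact ⟨hx'.2.2.1, .inl hx'.1, conf_nil_left _⟩
        · obtain ⟨h4, h5⟩ := h3 y hy
          refine ⟨hx'.2.2.1.trans h4, .inl hx'.1, ?_⟩
          rcases h5 with h5 | ⟨s', hs', hy'⟩
          · rw [h5.2]; exact conf_nil_left _
          · exact (before_of_segmentOK hP hS (hs s' (List.mem_cons_of_mem _ hs')) (hsort.1 _ hs')
              hx hy').2.2
    · intro m hm hms y hy
      have hm' := hms s List.mem_cons_self
      rw [weave] at hy
      rcases List.mem_cons.1 hy with rfl | hy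
      · exact ⟨hm', .inl ⟨List.mem_cons_self, rfl⟩⟩
      rcases List.mem_append.1 hy with hy | hy
      · have := hS.label y hy
        exact ⟨hm'.trans this.2.2.2, .inr ⟨s, List.mem_cons_self, hy⟩⟩
      rcases List.mem_cons.1 hy with rfl | hy
      · exact ⟨hm', .inl ⟨by simp, rfl⟩⟩
      · obtain ⟨h4, h5⟩ := h2 m hm (fun s hs' => hms s (List.mem_cons_of_mem _ hs')) y hy
        refine ⟨h4, h5.imp (fun h => ⟨by simp [h.1], h.2⟩) ?_⟩
        rintro ⟨s', hs', hy'⟩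
        exact ⟨s', List.mem_cons_of_mem _ hs', hy'⟩

end
end POH

/-! ### The segments visited in each round -/

namespace POH

section
variable {S : List (Bool × List Item)} {link : Bool}

/-- A stretch with its indexed vertices. -/
abbrev Block : Type := ((Bool × List Item) × ℕ) × List (VData × ℕ)

/-- The part of a block that is visited in the given round. -/
def roundSegments (L M R : Block → List (VData × ℕ)) : List (Bool × ℕ × (Block → List (VData × ℕ))) :=
  [(false, 1, L), (false, 1, R), (true, 2, M), (false, 3, M), (true, 4, L), (true, 4, R)]

def segments (h : List Block) (L M R : Block → List (VData × ℕ)) :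
    List ((ℕ × ℕ) × List (VData × ℕ)) :=
  (roundSegments L M R).flatMap fun r =>
    (h.filter fun p => p.1.1.1 == r.1).map fun p => ((p.1.2, r.2.1), r.2.2 p)

theorem segments_map_fst {h : List Block} {L M R : Block → List (VData × ℕ)}
    (hh : h.map Prod.fst = stretches S) : (segments h L M R).map Prod.fst = slots S := by
  simp only [segments, roundSegments, slots, rounds, ← hh, List.flatMap_cons, List.flatMap_nil,
    List.map_append, List.map_map, List.filter_map]
  rfl

/-- Every block has each of its three parts visited exactly once, although in different orders on
the two sides; so multiplicities are compared side by side. -/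
theorem segments_perm {h : List Block} {L M R : Block → List (VData × ℕ)}
    (hp : ∀ p ∈ h, p.2 = L p ++ M p ++ R p) :
    ((segments h L M R).flatMap Prod.snd).Perm (h.flatMap Prod.snd) := by
  classical
  have key : ∀ l : List Block, (∀ p ∈ l, p.2 = L p ++ M p ++ R p) → ∀ v,
      (l.flatMap Prod.snd).count v =
        (l.flatMap L).count v + (l.flatMap M).count v + (l.flatMap R).count v := by
    intro l
    induction l with
    | nil => simp
    | cons p l ih =>
      intro hl v
      have := ih (fun q hq => hl q (List.mem_cons_of_mem _ hq)) v
      have h1 := congrArg (List.count v) (hl p List.mem_cons_self)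
      simp only [List.count_append] at h1
      simp only [List.flatMap_cons, List.count_append]
      omega
  have hsub : ∀ b, ∀ p ∈ h.filter (fun p => p.1.1.1 == b), p.2 = L p ++ M p ++ R p :=
    fun b p hp' => hp p (List.mem_of_mem_filter hp')
  have hsplit : (h.filter (fun p => p.1.1.1 == true) ++ h.filter (fun p => p.1.1.1 == false)).Perm h := by
    have := List.filter_append_perm (fun p : Block => p.1.1.1 == true) h
    convert this using 4 with p
    cases p.1.1.1 <;> rfl
  refine List.perm_iff_count.2 fun v => ?_
  rw [← (hsplit.flatMap_right Prod.snd).count_eq v, List.flatMap_append, List.count_append,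
    key _ (hsub true), key _ (hsub false)]
  simp only [segments, roundSegments, List.flatMap_cons, List.flatMap_nil, List.append_nil,
    List.flatMap_append, List.flatMap_map, List.count_append]
  eta_reduce
  omega

theorem itemV_label (sd : Bool) (st : ℕ) (T : Item) : (itemV sd st T).kind = 0 ∧
    (itemV sd st T).st = st ∧ (itemV sd st T).lo = 1 ∧ (itemV sd st T).hi = 4 := by
  unfold itemV; split <;> simp

theorem hasHamCycle_of_selectable (hS : Selectable S) :
    (orderedGraph link (gadget S) valid_gadget).HasHamCycle := by
  obtain ⟨P, hsel, hP⟩ := hS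
  obtain ⟨V₁, V₂, hV, hV₁, hV₂⟩ : ∃ V₁ V₂, (gadget S).zipIdx = V₁ ++ V₂ ∧
      V₁.map Prod.fst = pathData S ∧ V₂.map Prod.fst = slotData S :=
    List.map_eq_append_iff.1 (List.zipIdx_map_fst 0 (gadget S))
  have hsorted : (V₁ ++ V₂).Pairwise fun u v => u.2 < v.2 := by
    rw [← hV, ← List.pairwise_map (f := Prod.snd) (R := (· < ·)), List.zipIdx_map_snd]
    exact List.pairwise_lt_range'
  have hchain : (V₁ ++ V₂).IsChain fun u v => u.2 + 1 = v.2 := by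
    rw [← hV, ← List.isChain_map (f := Prod.snd) (R := fun a b => a + 1 = b), List.zipIdx_map_snd]
    exact (List.isChain_range' _ _ _).imp fun a b h => h.symm
  obtain ⟨h, rfl, hst, hblock⟩ := exists_blocks Prod.fst chunk _ _ hV₁
  -- Each block is cut at its selected item. The two ends of the stretch make the outer parts
  -- non-empty, which matters because the entry and the exit of a slot are not adjacent. Blocks
  -- outside of `h` get a dummy value so that `choose` applies.
  have hparts : ∀ p : Block, ∃ t : List (VData × ℕ) × (VData × ℕ) × List (VData × ℕ), p ∈ h →
      p.2 = t.1 ++ [t.2.1] ++ t.2.2 ∧ t.1 ≠ [] ∧ t.2.2 ≠ [] ∧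
      (∃ T, P p.1.1.1 T ∧ t.2.1.1 = itemV p.1.1.1 p.1.2 T) ∧
      ∀ x ∈ t.1 ++ t.2.2, x.1 = endV p.1.1.1 p.1.2 ∨ ∃ T, x.1 = itemV p.1.1.1 p.1.2 T := by
    intro p
    by_cases hp : p ∈ h
    swap
    · exact ⟨([], (inV (0, 0), 0), []), fun h => absurd h hp⟩
    have hX : p.1 ∈ stretches S := by rw [← hst]; exact List.mem_map_of_mem hp
    obtain ⟨T, hT, hPT⟩ := hsel p.1.1 (List.fst_mem_of_mem_zipIdx hX)
    obtain ⟨l, r, hlr⟩ := List.mem_iff_append.1 hT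
    have hb := hblock p hp
    rw [chunk, hlr, show endV p.1.1.1 p.1.2 :: (l ++ T :: r).map (itemV p.1.1.1 p.1.2) ++
      [endV p.1.1.1 p.1.2] = (endV p.1.1.1 p.1.2 :: l.map (itemV p.1.1.1 p.1.2)) ++
        (itemV p.1.1.1 p.1.2 T :: (r.map (itemV p.1.1.1 p.1.2) ++ [endV p.1.1.1 p.1.2])) by simp,
      List.map_eq_append_iff] at hb
    obtain ⟨l', m', h1, h2, h3⟩ := hb
    rw [List.map_eq_cons_iff] at h3
    obtain ⟨m, r', rfl, h4, h5⟩ := h3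
    refine ⟨(l', m, r'), fun _ => ⟨by simpa using h1, ?_, ?_, ⟨T, hPT, h4⟩, fun x hx => ?_⟩⟩
    · rintro rfl; simp at h2
    · rintro rfl; simp at h5
    · rcases List.mem_append.1 hx with hx | hx
      · have := List.mem_map_of_mem (f := Prod.fst) hx
        rw [h2, List.mem_cons, List.mem_map] at this
        rcases this with h | ⟨T, -, h⟩
        exacts [.inl h, .inr ⟨T, h.symm⟩]
      · have := List.mem_map_of_mem (f := Prod.fst) hx
        rw [h5, List.mem_append, List.mem_map, List.mem_singleton] at this
        rcases this with ⟨T, -, h⟩ | h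
        exacts [.inr ⟨T, h.symm⟩, .inl h]
  choose t ht using hparts
  let L : Block → List (VData × ℕ) := fun p => (t p).1
  let M : Block → List (VData × ℕ) := fun p => [(t p).2.1]
  let R : Block → List (VData × ℕ) := fun p => (t p).2.2
  have hperm := segments_perm (L := L) (M := M) (R := R) (fun p hp => (ht p hp).1)
  have hfst := segments_map_fst (L := L) (M := M) (R := R) hst
  have hblockchain : ∀ p ∈ h, (L p ++ M p ++ R p).IsChain fun u v => u.2 + 1 = v.2 := by
    intro p hp
    rw [← (ht p hp).1]
    refine (hchain.left_of_append).infix ?_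
    rw [List.flatMap_def]
    exact List.infix_of_mem_flatten (List.mem_map_of_mem hp)
  have hok : ∀ s ∈ segments h L M R, SegmentOK P s := by
    intro s hs
    simp only [segments, List.mem_flatMap, List.mem_map, List.mem_filter, beq_iff_eq] at hs
    obtain ⟨⟨sd, ph, sel⟩, hr, p, ⟨hp, rfl⟩, rfl⟩ := hs
    obtain ⟨-, hL, hR, ⟨T, hT, hM⟩, hLR⟩ := ht p hp
    have hc := hblockchain p hp
    have hcL := hc.left_of_append.left_of_append
    have hcR := hc.right_of_append
    have hM' : ∀ x ∈ M p, x.1 = itemV p.1.1.1 p.1.2 T := fun x hx => by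
      rw [List.mem_singleton.1 hx]; exact hM
    have hL' := fun x hx => hLR x (List.mem_append_left _ hx)
    have hR' := fun x hx => hLR x (List.mem_append_right _ hx)
    -- Unselected vertices go to phase 1 on side `false` and to phase 4 on side `true`, which is
    -- harmless for every conflict.
    have side : ∀ l : List (VData × ℕ), l ≠ [] → l.IsChain (fun u v => u.2 + 1 = v.2) →
        (∀ x ∈ l, x.1 = endV p.1.1.1 p.1.2 ∨ ∃ T, x.1 = itemV p.1.1.1 p.1.2 T) →
        SegmentOK P ((p.1.2, if p.1.1.1 then 4 else 1), l) := by
      intro l hne hl hx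
      refine ⟨hne, hl, fun x hxl => ?_, ?_⟩
      · rcases hx x hxl with e | ⟨T, e⟩ <;> rw [e] <;> cases p.1.1.1 <;> simp [endV, itemV]
      · cases hsd : p.1.1.1 with
        | false =>
          refine .inl ⟨fun x hxl => ?_, .inl rfl⟩
          rcases hx x hxl with e | ⟨T, e⟩ <;> rw [e, hsd] <;> simp [endV, itemV]
        | true =>
          refine .inr ⟨fun x hxl => ?_, .inl rfl⟩
          rcases hx x hxl with e | ⟨T, e⟩ <;> rw [e, hsd] <;> simp [endV, itemV]
    have mid : SegmentOK P ((p.1.2, selPhase p.1.1.1), M p) := by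
      refine ⟨by simp [M], List.isChain_singleton _, fun x hx => ?_, ?_⟩
      · rw [hM' x hx]
        have := itemV_label p.1.1.1 p.1.2 T
        have : 1 ≤ selPhase p.1.1.1 ∧ selPhase p.1.1.1 ≤ 4 := by
          unfold selPhase; split <;> simp
        simp only
        omega
      · cases hsd : p.1.1.1 with
        | false =>
          refine .inl ⟨fun x hx => by rw [hM' x hx, hsd]; rfl, .inr ⟨rfl, fun x hx => ?_⟩⟩
          rw [hM' x hx, hsd]; rwa [hsd] at hT
        | true =>
          refine .inr ⟨fun x hx => by rw [hM' x hx, hsd]; rfl, .inr ⟨rfl, fun x hx => ?_⟩⟩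
          rw [hM' x hx, hsd]; rwa [hsd] at hT
    have sL := side _ hL hcL hL'
    have sR := side _ hR hcR hR'
    simp only [roundSegments, List.mem_cons, Prod.mk.injEq, List.not_mem_nil, or_false] at hr
    rcases hr with ⟨e, rfl, rfl⟩ | ⟨e, rfl, rfl⟩ | ⟨e, rfl, rfl⟩ | ⟨e, rfl, rfl⟩ | ⟨e, rfl, rfl⟩ |
      ⟨e, rfl, rfl⟩ <;> rw [e] at mid sL sR
    exacts [sL, sR, mid, mid, sL, sR]
  have hslotmem : ∀ s ∈ segments h L M R, s.1 ∈ slots S := fun s hs => by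
    rw [← hfst]; exact List.mem_map_of_mem hs
  have hsort : (segments h L M R).Pairwise fun s s' => s.1.2 ≤ s'.1.2 := by
    have := slots_sorted (S := S)
    rw [← hfst, List.pairwise_map] at this
    exact this
  rw [slotData, List.cons_append, List.map_eq_cons_iff] at hV₂
  obtain ⟨⟨_, i⟩, w, rfl, rfl, hw⟩ := hV₂
  have hframes : Frames (segments h L M R) w := by
    rw [Frames, hw, ← hfst, List.flatMap_map]
  have hw1 := hsorted.sublist (List.sublist_append_right _ _)
  rw [List.pairwise_cons] at hw1
  obtain ⟨hbefore, hrest⟩ := weave_before hP hok hsort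
    (fun s hs => (phase_of_mem_slots (hslotmem s hs)).2.2.trans (by omega)) hframes hw1.2
  have hadj := weave_chain (link := link) hok hframes (p := (outV (0, 0), i)) rfl
    hchain.right_of_append
  have hperm' := weave_perm hframes
  obtain ⟨Q, k, hQ⟩ := weave_last hframes
  have htotal : ((outV (0, 0), i) :: weave (segments h L M R) w).Perm (gadget S).zipIdx := by
    rw [hV]
    exact (((hperm'.trans (hperm.append_right w)).cons _).trans List.perm_middle.symm)
  have hidx : (gadget S).zipIdx.Pairwise fun u v => u.2 ≠ v.2 := by
    rw [hV]; exact hsorted.imp fun h => h.ne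
  have hall : ((outV (0, 0), i) :: weave (segments h L M R) w).Pairwise Before := by
    refine List.pairwise_cons.2 ⟨fun y hy => ?_, hbefore⟩
    obtain ⟨-, h1⟩ := hrest 0 (by omega) (fun _ _ => by omega) y hy
    refine ⟨Nat.zero_le _, ?_, conf_nil_right _⟩
    rcases h1 with h1 | ⟨s, hs, hy⟩
    · exact .inr (.inr (hw1.1 _ h1.1))
    · exact .inr (.inl ((hok s hs).label y hy).1)
  have hall' := hall.and ((htotal.pairwise_iff fun h => h.symm).2 hidx)
  rw [hQ] at htotal hadj hall'
  refine hasHamCycle_of_vertexList valid_gadget htotal hadj (hall'.imp fun {u v} h => ?_) ?_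
  · exact precB_eq_false h.1 (fun e => h.2 (congrArg Prod.snd e)) fun e => absurd e h.2
  · rw [adjB, Bool.or_eq_true, adjHalf_iff]
    exact .inl (.inr (.inr (.inr ⟨rfl, rfl⟩)))

theorem hasHamPath_iff_selectable :
    (orderedGraph link (gadget S) valid_gadget).HasHamPath ↔ Selectable S :=
  ⟨selectable_of_hasHamPath, fun h =>
    let ⟨a, b, p, hp, _, he⟩ := hasHamCycle_of_selectable h
    ⟨a, b, p, hp, he⟩⟩

theorem hasHamCycle_iff_selectable :
    (orderedGraph link (gadget S) valid_gadget).HasHamCycle ↔ Selectable S :=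
  ⟨fun ⟨a, b, p, hp, _, he⟩ => selectable_of_hasHamPath ⟨a, b, p, hp, he⟩,
    hasHamCycle_of_selectable⟩

end
end POH

namespace POH

/-! ### The distance parameters of the gadget graph -/

/-- By `hconv` the indices fill an interval; subtracting the least one gives the isomorphism. -/
theorem isPathGraph_of_index {V : Type} [Finite V] [Nonempty V] {H : SimpleGraph V} (idx : V → ℕ)
    (hinj : Function.Injective idx)
    (hadj : ∀ u v, H.Adj u v ↔ idx u + 1 = idx v ∨ idx v + 1 = idx u)
    (hconv : ∀ u v i, idx u ≤ i → i ≤ idx v → ∃ w, idx w = i) : IsPathGraph H := by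
  obtain ⟨a, ha⟩ := Finite.exists_min idx
  obtain ⟨b, hb⟩ := Finite.exists_max idx
  refine ⟨idx b - idx a, ⟨⟨Equiv.ofBijective
    (fun v => ⟨idx v - idx a, by have := hb v; omega⟩) ⟨fun u v h => hinj ?_, fun i => ?_⟩, ?_⟩⟩⟩
  · have h' := congrArg Fin.val h
    have := ha u
    have := ha v
    change idx u - idx a = idx v - idx a at h'
    omega
  · obtain ⟨w, hw⟩ := hconv a b (idx a + i) (by omega) (by have := i.2; have := ha b; omega)
    exact ⟨w, Fin.ext (by simp only; omega)⟩
  · intro u v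
    have := ha u
    have := ha v
    rw [SimpleGraph.pathGraph_adj, hadj]
    change (idx u - idx a + 1 = idx v - idx a ∨ idx v - idx a + 1 = idx u - idx a) ↔ _
    omega

section
variable {S : List (Bool × List Item)}

theorem lo_of_mem_pathData {v : VData} (h : v ∈ pathData S) : v.lo ≠ 0 ∧ v.lo ≠ 5 := by
  obtain ⟨X, -, rfl | ⟨T, -, rfl⟩⟩ := mem_pathData.1 h
  · unfold endV; split <;> simp
  · unfold itemV; split <;> simp

theorem pathData_sorted : (pathData S).Pairwise fun u v => u.st ≤ v.st := by
  have hst : ∀ X, ∀ v ∈ chunk X, v.st = X.2 := by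
    intro X v hv
    simp only [chunk, List.mem_append, List.mem_cons, List.mem_map, List.not_mem_nil,
      or_false] at hv
    rcases hv with (rfl | ⟨T, -, rfl⟩) | rfl
    · unfold endV; split <;> rfl
    · exact (itemV_label _ _ _).2.1
    · unfold endV; split <;> rfl
  have hlt : (stretches S).Pairwise fun X Y => X.2 < Y.2 := by
    rw [← List.pairwise_map (f := Prod.snd) (R := (· < ·)), stretches, List.zipIdx_map_snd]
    exact List.pairwise_lt_range'
  rw [pathData, List.pairwise_flatMap]
  refine ⟨fun X _ => List.pairwise_iff_getElem.2 fun i j hi hj _ => ?_,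
    hlt.imp fun {X Y} h u hu v hv => ?_⟩
  · rw [hst X _ (List.getElem_mem hi), hst X _ (List.getElem_mem hj)]
  · rw [hst X u hu, hst Y v hv]; exact h.le

/-- The entries and exits of the slots. -/
def slotVerts (S : List (Bool × List Item)) : Finset (Fin (gadget S).length) :=
  Finset.univ.filter fun i => (pathData S).length ≤ i

theorem card_slotVerts_le : (slotVerts S).card ≤ 2 + 12 * S.length := by
  have h1 : (slots S).length ≤ 6 * S.length := by
    have h := fun b : Bool =>
      List.length_filter_le (fun X : (Bool × List Item) × ℕ => X.1.1 == b) (stretches S)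
    have ht := h true
    have hf := h false
    have e : (stretches S).length = S.length := List.length_zipIdx
    simp only [slots, rounds, List.flatMap_cons, List.flatMap_nil, List.length_append,
      List.length_map, List.length_nil]
    omega
  have h2 : (slotData S).length = 2 + 2 * (slots S).length := by
    have : ∀ l : List (ℕ × ℕ), (l.flatMap fun s => [inV s, outV s]).length = 2 * l.length := by
      intro l
      induction l with
      | nil => rfl
      | cons s l ih =>
        rw [List.flatMap_cons, List.length_append, ih, List.length_cons, List.length_cons,
          List.length_cons, List.length_nil]
        omega
    simp only [slotData, List.length_append, List.length_cons, List.length_nil, this]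
    omega
  calc (slotVerts S).card ≤ (Finset.range (slotData S).length).card := by
        refine Finset.card_le_card_of_injOn (fun i => i - (pathData S).length) (fun i hi => ?_)
          fun i hi j hj hij => Fin.ext ?_
        · have := i.2
          have e : (gadget S).length = (pathData S).length + (slotData S).length :=
            List.length_append
          have := (Finset.mem_filter.1 hi).2
          simp only [Finset.coe_range, Set.mem_Iio]
          omega
        · have := (Finset.mem_filter.1 hi).2
          have := (Finset.mem_filter.1 hj).2
          simp only at hij
          omega
    _ ≤ _ := by rw [Finset.card_range]; omega

theorem gadget_getElem_lt {i : ℕ} (hi : i < (gadget S).length) (h : i < (pathData S).length) :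
    (gadget S)[i] = (pathData S)[i] := List.getElem_append_left h

theorem mem_pathData_of_lt {i : ℕ} (hi : i < (gadget S).length) (h : i < (pathData S).length) :
    (gadget S)[i] ∈ pathData S := by
  rw [gadget_getElem_lt hi h]; exact List.getElem_mem h

theorem mem_slotData_of_le {i : ℕ} (hi : i < (gadget S).length) (h : (pathData S).length ≤ i) :
    (gadget S)[i] ∈ slotData S := by
  have : (gadget S)[i] = (slotData S)[i - (pathData S).length]'(by
    have : (gadget S).length = (pathData S).length + (slotData S).length := List.length_append
    omega) := List.getElem_append_right h
  rw [this]; exact List.getElem_mem _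

theorem lt_of_not_mem_slotVerts (u : ↥((slotVerts S : Set (Fin (gadget S).length))ᶜ)) :
    (u.1 : ℕ) < (pathData S).length := by
  have := u.2
  simp only [slotVerts, Set.mem_compl_iff, Finset.mem_coe, Finset.mem_filter, Finset.mem_univ,
    true_and] at this
  omega

theorem st_mono {i j : ℕ} (hi : i < (gadget S).length) (hj : j < (gadget S).length) (hij : i ≤ j)
    (h : j < (pathData S).length) : (gadget S)[i].st ≤ (gadget S)[j].st := by
  rcases hij.eq_or_lt with rfl | hij
  · exact le_rfl
  · rw [gadget_getElem_lt hi (by omega), gadget_getElem_lt hj h]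
    exact List.pairwise_iff_getElem.1 pathData_sorted i j _ _ hij

theorem adjHalf_path {link : Bool} {i j : Fin (gadget S).length} (hi : (i : ℕ) < (pathData S).length)
    (hj : (j : ℕ) < (pathData S).length) :
    adjHalf link (vtx (gadget S) i) (vtx (gadget S) j) = true ↔
      (i : ℕ) + 1 = j ∧ (link = true ∨ (gadget S)[i].st = (gadget S)[j].st) := by
  have h1 := kind_of_mem_pathData (mem_pathData_of_lt i.2 hi)
  have h2 := kind_of_mem_pathData (mem_pathData_of_lt j.2 hj)
  have h3 := lo_of_mem_pathData (mem_pathData_of_lt i.2 hi)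
  rw [adjHalf_iff]
  simp only [vtx, Fin.getElem_fin, h1, h2, h3.1]
  simp

theorem adjB_path_slot {link : Bool} {i j : Fin (gadget S).length}
    (hi : (i : ℕ) < (pathData S).length) (hj : (pathData S).length ≤ (j : ℕ)) :
    adjB link (vtx (gadget S) i) (vtx (gadget S) j) = true ↔
      (gadget S)[j].st = (gadget S)[i].st := by
  have h1 := kind_of_mem_pathData (mem_pathData_of_lt i.2 hi)
  have h2 := kind_of_mem_slotData (mem_slotData_of_le j.2 hj)
  have h3 := lo_of_mem_pathData (mem_pathData_of_lt i.2 hi)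
  rw [adjB, Bool.or_eq_true, adjHalf_iff, adjHalf_iff]
  simp only [vtx, Fin.getElem_fin, h1, h2, h3.1, h3.2]
  simpa using fun _ => h2

theorem deleteVerts_adj {link : Bool} (u v : ↥((slotVerts S : Set (Fin (gadget S).length))ᶜ)) :
    (deleteVerts (dataGraph link (gadget S)) (slotVerts S)).Adj u v ↔
      ((u.1 : ℕ) + 1 = v.1 ∨ (v.1 : ℕ) + 1 = u.1) ∧
        (link = true ∨ (gadget S)[u.1].st = (gadget S)[v.1].st) := by
  change adjB link (vtx (gadget S) u.1) (vtx (gadget S) v.1) = true ↔ _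
  have hu := lt_of_not_mem_slotVerts u
  have hv := lt_of_not_mem_slotVerts v
  rw [adjB, Bool.or_eq_true, adjHalf_path hu hv, adjHalf_path hv hu,
    eq_comm (a := (gadget S)[v.1].st)]
  tauto

/-- With links, the stretches form one path on consecutive indices. Some stretch must exist, because
a path has at least one vertex. -/
theorem distToPath_gadget_le (hS : S ≠ []) :
    distToPath (dataGraph true (gadget S)) ≤ 2 + 12 * S.length := by
  refine le_trans (Nat.sInf_le ⟨slotVerts S, rfl, ?_⟩) card_slotVerts_le
  have hlen : 0 < (pathData S).length := by
    obtain ⟨X, S, rfl⟩ := List.exists_cons_of_ne_nil hS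
    simp [pathData, stretches, List.zipIdx_cons, chunk]
  have hle : (pathData S).length ≤ (gadget S).length := by simp [gadget]
  have mem : ∀ i (hi : i < (pathData S).length),
      (⟨i, by omega⟩ : Fin (gadget S).length) ∈ (slotVerts S : Set (Fin (gadget S).length))ᶜ := by
    intro i hi
    simp [slotVerts, hi]
  have : Nonempty ↥((slotVerts S : Set (Fin (gadget S).length))ᶜ) := ⟨⟨_, mem 0 hlen⟩⟩
  refine isPathGraph_of_index (V := ↥((slotVerts S : Set (Fin (gadget S).length))ᶜ))
    (fun u => (u.1 : ℕ)) (fun u v h => Subtype.ext (Fin.ext h))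
    (fun u v => by rw [deleteVerts_adj]; simp) fun u v i _ hi => ?_
  have := lt_of_not_mem_slotVerts v
  exact ⟨⟨_, mem i (by omega)⟩, rfl⟩

/-- Without links, edges preserve the stretch number. Conversely, stretch numbers increase weakly
with the index, so everything between two vertices of one stretch belongs to it. -/
theorem reachable_iff_st (u v : ↥((slotVerts S : Set (Fin (gadget S).length))ᶜ)) :
    (deleteVerts (dataGraph false (gadget S)) (slotVerts S)).Reachable u v ↔
      (gadget S)[u.1].st = (gadget S)[v.1].st := by
  constructor
  · rintro ⟨p⟩
    induction p with
    | nil => rfl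
    | cons h _ ih =>
      rw [← ih]
      exact ((deleteVerts_adj _ _).1 h).2.resolve_left (by simp)
  · have key : ∀ n, ∀ u v : ↥((slotVerts S : Set (Fin (gadget S).length))ᶜ),
        (v.1 : ℕ) = u.1 + n → (gadget S)[u.1].st = (gadget S)[v.1].st →
        (deleteVerts (dataGraph false (gadget S)) (slotVerts S)).Reachable
          u v := by
      intro n
      induction n with
      | zero =>
        intro u v h _
        rw [show u = v from Subtype.ext (Fin.ext (by omega))]
      | succ n ih =>
        intro u v h hst
        have hv := lt_of_not_mem_slotVerts v
        have hu := u.1.2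
        have hv' := v.1.2
        have hlt : (u.1 : ℕ) + 1 < (gadget S).length := by omega
        let x : ↥((slotVerts S : Set (Fin (gadget S).length))ᶜ) := ⟨⟨u.1 + 1, hlt⟩, by
          simp [slotVerts]; omega⟩
        have h1 : (gadget S)[u.1].st ≤ (gadget S)[x.1].st := st_mono hu hlt (by omega) (by omega)
        have h2 : (gadget S)[x.1].st ≤ (gadget S)[v.1].st := st_mono hlt hv' (by omega) hv
        refine SimpleGraph.Reachable.trans (SimpleGraph.Adj.reachable
          ((deleteVerts_adj u x).2 ⟨.inl rfl, .inr (by omega)⟩)) (ih x v ?_ (by omega))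
        simp only [x]; omega
    intro h
    rcases le_total (u.1 : ℕ) v.1 with hle | hle
    · exact key (v.1 - u.1) u v (by omega) h
    · exact (key (u.1 - v.1) v u (by omega) h.symm).symm

theorem distToLinearForestModules_gadget_le :
    distToLinearForestModules (dataGraph false (gadget S)) ≤
      2 + 12 * S.length := by
  refine le_trans (Nat.sInf_le ⟨slotVerts S, rfl, fun C => ?_, fun C => ?_⟩) card_slotVerts_le
  · obtain ⟨c, rfl⟩ := C.exists_rep
    have hmem : ∀ v, v ∈ (SimpleGraph.connectedComponentMk (deleteVerts
        (dataGraph false (gadget S)) (slotVerts S)) c).supp ↔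
        (gadget S)[v.1].st = (gadget S)[c.1].st := fun v => by
      rw [SimpleGraph.ConnectedComponent.mem_supp_iff, SimpleGraph.ConnectedComponent.eq,
        reachable_iff_st]
    have : Nonempty (SimpleGraph.connectedComponentMk (deleteVerts
        (dataGraph false (gadget S)) (slotVerts S)) c).supp :=
      ⟨⟨c, (hmem c).2 rfl⟩⟩
    have : Finite ↥((slotVerts S : Set (Fin (gadget S).length))ᶜ) := inferInstance
    refine isPathGraph_of_index (V := (SimpleGraph.connectedComponentMk (deleteVerts
        (dataGraph false (gadget S)) (slotVerts S)) c).supp)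
      (fun u => (u.1.1 : ℕ)) (fun u v h => Subtype.ext (Subtype.ext (Fin.ext h)))
      (fun u v => ?_) fun u v i hui hiv => ?_
    · refine (deleteVerts_adj u.1 v.1).trans (and_iff_left (.inr ?_))
      rw [(hmem u.1).1 u.2, (hmem v.1).1 v.2]
    · have hv := lt_of_not_mem_slotVerts v.1
      have hu' := u.1.1.2
      have hv' := v.1.1.2
      have hi : i < (gadget S).length := by omega
      let x : ↥((slotVerts S : Set (Fin (gadget S).length))ᶜ) := ⟨⟨i, hi⟩, by
        simp [slotVerts]; omega⟩
      have h1 : (gadget S)[u.1.1].st ≤ (gadget S)[x.1].st := st_mono hu' hi hui (by omega)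
      have h2 : (gadget S)[x.1].st ≤ (gadget S)[v.1.1].st := st_mono hi hv' hiv hv
      have h3 := (hmem u.1).1 u.2
      have h4 := (hmem v.1).1 v.2
      exact ⟨⟨x, (hmem x).2 (by omega)⟩, rfl⟩
  · constructor
    · refine Set.ssubset_univ_iff.2 fun h => ?_
      -- The first slot vertex lies outside of every component, so the module is a proper subset.
      have hlt : (pathData S).length < (gadget S).length := by simp [gadget, slotData]
      have : (⟨(pathData S).length, hlt⟩ : Fin (gadget S).length) ∈ Subtype.val '' C.supp := by
        rw [h]; trivial
      obtain ⟨y, -, hy⟩ := this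
      have h1 := lt_of_not_mem_slotVerts y
      rw [hy] at h1
      exact absurd h1 (lt_irrefl _)
    -- An outside neighbour of the component must be a slot vertex, and its adjacency to stretch
    -- vertices depends on their stretch number alone.
    · rintro _ ⟨u, hu, rfl⟩ _ ⟨v, hv, rfl⟩ w hw huw
      have huv : (gadget S)[u.1].st = (gadget S)[v.1].st := by
        rw [← reachable_iff_st, ← SimpleGraph.ConnectedComponent.eq]
        exact hu.trans hv.symm
      have hu' := lt_of_not_mem_slotVerts u
      have hv' := lt_of_not_mem_slotVerts v
      by_cases hwS : (pathData S).length ≤ (w : ℕ)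
      · exact (adjB_path_slot hv' hwS).2 (((adjB_path_slot hu' hwS).1 huw).trans huv)
      · refine absurd ⟨⟨w, ?_⟩, ?_, rfl⟩ hw
        · simpa [slotVerts] using hwS
        · rw [← hu]
          exact SimpleGraph.ConnectedComponent.sound (SimpleGraph.Adj.reachable
            (G := deleteVerts (dataGraph false (gadget S)) (slotVerts S))
            huw.symm)

end
end POH

namespace POH

/-! ### Selection of the values of a satisfying assignment

A set of `k` variables among `n` is described by its values `0 = x₀ < x₁ < ⋯ < xₖ < xₖ₊₁ = n + 1`,
where the variable `v` has the value `v + 1`. The triple `(j, a, b)` stands for `xⱼ = a` and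
`xⱼ₊₁ = b`; it is sufficient to falsify a literal. -/

/-- The literal is false if the interval `[a, b)` is one of the intervals `[xⱼ, xⱼ₊₁)`. -/
def falsifies (x : ℕ × ℕ × ℕ) (l : ℕ × Bool) : Bool :=
  if l.2 = true then decide (x.2.1 < l.1 + 1) && decide (l.1 + 1 < x.2.2) else x.2.1 == l.1 + 1

/-- The first condition makes the selected values increase from `0` to `n + 1`; the second excludes
tuples of intervals that refute all literals of a clause. -/
def bad (n k : ℕ) (cl : List (List (ℕ × Bool))) (T : Item) : Bool :=
  (T.any fun x => decide (x.2.2 ≤ x.2.1) || (x.1 == 0 && !(x.2.1 == 0)) ||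
    (x.1 == k && !(x.2.2 == n + 1))) ||
  cl.any fun C => C.all fun l => T.any fun x => falsifies x l

/-- For every `d`-tuple of indices, the list of all possible items. -/
def tupleStretches (n k : ℕ) : ℕ → List (List Item)
  | 0 => [[[]]]
  | d + 1 => (List.range (k + 1)).flatMap fun j => (tupleStretches n k d).map fun X =>
      (List.range (n + 2)).flatMap fun a => (List.range (n + 2)).flatMap fun b =>
        X.map fun T => (j, a, b) :: T

/-- The last component is a placeholder: `conf` never reads it in its second argument. -/
def valueStretches (n k : ℕ) : List (List Item) :=
  (List.range (k + 2)).map fun j => (List.range (n + 2)).map fun h => [(j, h, 0)]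

def cnfStretches (d n k : ℕ) (cl : List (List (ℕ × Bool))) : List (Bool × List Item) :=
  ((tupleStretches n k d).map fun X => (false, X.filter fun T => !bad n k cl T)) ++
    (valueStretches n k).map fun X => (true, X)

/-- Some `k` of the variables below `n` satisfy all clauses. -/
def SatisfiableWith (n k : ℕ) (cl : List (List (ℕ × Bool))) : Prop :=
  ∃ S : Finset ℕ, S.card = k ∧ (∀ v ∈ S, v < n) ∧
    ∀ C ∈ cl, ∃ l ∈ C, (l.1 ∈ S ↔ l.2 = true)

theorem length_cnfStretches (d n k : ℕ) (cl : List (List (ℕ × Bool))) :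
    (cnfStretches d n k cl).length = (k + 1) ^ d + (k + 2) := by
  have : ∀ d, (tupleStretches n k d).length = (k + 1) ^ d := by
    intro d
    induction d with
    | zero => rfl
    | succ d ih => simp [tupleStretches, List.length_flatMap, ih, pow_succ, mul_comm]
  simp [cnfStretches, valueStretches, this]

theorem mem_tupleStretches {n k d : ℕ} {X : List Item} (hX : X ∈ tupleStretches n k d) :
    ∃ I : List ℕ, I.length = d ∧ (∀ j ∈ I, j ≤ k) ∧
      ∀ T, T ∈ X ↔ T.map Prod.fst = I ∧ ∀ x ∈ T, x.2.1 < n + 2 ∧ x.2.2 < n + 2 := by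
  induction d generalizing X with
  | zero =>
    rw [tupleStretches, List.mem_singleton] at hX
    subst hX
    refine ⟨[], rfl, by simp, fun T => ?_⟩
    simp only [List.mem_singleton, List.map_eq_nil_iff]
    exact ⟨by rintro rfl; simp, fun h => h.1⟩
  | succ d ih =>
    simp only [tupleStretches, List.mem_flatMap, List.mem_map, List.mem_range] at hX
    obtain ⟨j, hj, Y, hY, rfl⟩ := hX
    obtain ⟨I, h1, h2, h3⟩ := ih hY
    refine ⟨j :: I, by simp [h1], ?_, fun T => ?_⟩
    · simp only [List.mem_cons, forall_eq_or_imp]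
      exact ⟨by omega, h2⟩
    · simp only [List.mem_flatMap, List.mem_map, List.mem_range]
      constructor
      · rintro ⟨a, ha, b, hb, T, hT, rfl⟩
        rw [h3] at hT
        simp only [List.map_cons, hT.1, List.mem_cons, forall_eq_or_imp, true_and]
        exact ⟨⟨ha, hb⟩, hT.2⟩
      · rintro ⟨h4, h5⟩
        rw [List.map_eq_cons_iff] at h4
        obtain ⟨⟨j, a, b⟩, T, rfl, rfl, h6⟩ := h4
        simp only [List.mem_cons, forall_eq_or_imp] at h5
        exact ⟨a, h5.1.1, b, h5.1.2, T, (h3 T).2 ⟨h6, h5.2⟩, rfl⟩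

theorem exists_tupleStretch {n k d : ℕ} {I : List ℕ} (hI : I.length = d) (hk : ∀ j ∈ I, j ≤ k) :
    ∃ X ∈ tupleStretches n k d, ∀ T ∈ X, T.map Prod.fst = I := by
  induction d generalizing I with
  | zero =>
    rw [List.length_eq_zero_iff] at hI
    subst hI
    exact ⟨[[]], by simp [tupleStretches], by simp⟩
  | succ d ih =>
    obtain ⟨j, I, rfl⟩ := List.exists_cons_of_length_eq_add_one hI
    obtain ⟨X, hX, h⟩ := ih (I := I) (by simpa using hI)
      fun i hi => hk i (List.mem_cons_of_mem _ hi)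
    refine ⟨(List.range (n + 2)).flatMap fun a => (List.range (n + 2)).flatMap fun b =>
      X.map fun T => (j, a, b) :: T, ?_, fun T hT => ?_⟩
    · simp only [tupleStretches, List.mem_flatMap, List.mem_map, List.mem_range]
      exact ⟨j, by have := hk j List.mem_cons_self; omega, X, hX, rfl⟩
    · simp only [List.mem_flatMap, List.mem_map, List.mem_range] at hT
      obtain ⟨a, -, b, -, T, hT, rfl⟩ := hT
      simp [h T hT]

/-- The values of a set of `k` variables. -/
structure Values (n k : ℕ) (S : Finset ℕ) (x : ℕ → ℕ) : Prop where
  zero : x 0 = 0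
  last : x (k + 1) = n + 1
  lt : ∀ j ≤ k, x j < x (j + 1)
  mem : ∀ v, v ∈ S ↔ ∃ j, 1 ≤ j ∧ j ≤ k ∧ x j = v + 1

theorem Values.mono {n k : ℕ} {S : Finset ℕ} {x : ℕ → ℕ} (h : Values n k S x) {i j : ℕ}
    (hij : i < j) (hj : j ≤ k + 1) : x i < x j := by
  induction j with
  | zero => omega
  | succ j ih =>
    have := h.lt j (by omega)
    rcases Nat.lt_succ_iff_lt_or_eq.1 hij with h1 | rfl
    · exact (ih h1 (by omega)).trans this
    · exact this

theorem exists_values {n k : ℕ} {S : Finset ℕ} (hk : S.card = k) (hn : ∀ v ∈ S, v < n) :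
    ∃ x, Values n k S x := by
  let e := S.orderEmbOfFin hk
  have he : ∀ i, e i ∈ S := fun i => S.orderEmbOfFin_mem hk i
  have hx : ∀ j (h1 : 1 ≤ j) (h2 : j ≤ k), (if j = 0 then 0 else if h : j - 1 < k then
      e ⟨j - 1, h⟩ + 1 else n + 1) = e ⟨j - 1, by omega⟩ + 1 := fun j h1 h2 => by
    rw [if_neg (by omega), dif_pos (by omega)]
  refine ⟨fun j => if j = 0 then 0 else if h : j - 1 < k then e ⟨j - 1, h⟩ + 1 else n + 1,
    rfl, by simp, fun j hj => ?_, fun v => ?_⟩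
  · rcases Nat.eq_zero_or_pos j with rfl | hj0
    · rw [if_pos rfl, if_neg (by omega)]
      split <;> omega
    · rw [hx j hj0 hj]
      rcases hj.lt_or_eq with h | rfl
      · rw [hx (j + 1) (by omega) (by omega)]
        have : e ⟨j - 1, by omega⟩ < e ⟨j + 1 - 1, by omega⟩ :=
          e.lt_iff_lt.2 (by rw [Fin.lt_def]; simp only; omega)
        omega
      · rw [if_neg (by omega), dif_neg (by omega)]
        have := hn _ (he ⟨j - 1, by omega⟩)
        omega
  · constructor
    · intro hv
      have : v ∈ Set.range e := by rw [Finset.range_orderEmbOfFin]; exact hv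
      obtain ⟨i, rfl⟩ := this
      refine ⟨i + 1, by omega, by omega, ?_⟩
      rw [hx (i + 1) (by omega) (by omega)]
      rfl
    · rintro ⟨j, h1, h2, h⟩
      rw [hx j h1 h2] at h
      rw [← show e ⟨j - 1, by omega⟩ = v by omega]
      exact he _

/-- Falsity has a local witness: a chosen variable is the left end of an interval, and a variable
that is not chosen lies strictly inside of one. -/
theorem Values.satisfies {n k : ℕ} {S : Finset ℕ} {x : ℕ → ℕ} (h : Values n k S x) {l : ℕ × Bool}
    (hl : l.1 < n) : (l.1 ∈ S ↔ l.2 = true) ↔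
      ∀ j ≤ k, falsifies (j, x j, x (j + 1)) l = false := by
  obtain ⟨v, b⟩ := l
  rw [h.mem]
  cases b with
  | false =>
    simp only [falsifies, Bool.false_eq_true, if_false, beq_eq_false_iff_ne, iff_false, not_exists,
      not_and]
    refine ⟨fun h1 j hj h2 => ?_, fun h1 j _ hj => h1 j hj⟩
    rcases Nat.eq_zero_or_pos j with rfl | hj0
    · rw [h.zero] at h2; omega
    · exact h1 j hj0 hj h2
  | true =>
    simp only [falsifies, if_true, iff_true, Bool.and_eq_false_iff, decide_eq_false_iff_not, not_lt]
    constructor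
    · rintro ⟨i, hi, hik, e⟩ j hj
      rw [← e]
      rcases le_or_gt i j with hij | hij
      · rcases hij.eq_or_lt with rfl | hij
        · exact .inl le_rfl
        · exact .inl (h.mono hij (by omega)).le
      · rcases (show j + 1 ≤ i from hij).eq_or_lt with rfl | hij
        · exact .inr le_rfl
        · exact .inr (h.mono hij (by omega)).le
    · intro h1
      by_contra hne
      -- If no interval has `v + 1` in its interior and `v + 1` is no value, then the values can
      -- never pass `v + 1`, although the last one is `n + 1`.
      have key : ∀ j ≤ k + 1, x j ≤ v + 1 := by
        intro j
        induction j with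
        | zero => intro _; rw [h.zero]; omega
        | succ j ih =>
          intro hj
          have h2 := ih (by omega)
          rcases h1 j (by omega) with h3 | h3
          · refine absurd ⟨j, ?_, by omega, le_antisymm h2 h3⟩ hne
            rcases Nat.eq_zero_or_pos j with rfl | hj0
            · rw [h.zero] at h3; omega
            · exact hj0
          · exact h3
      have := key (k + 1) le_rfl
      rw [h.last] at this
      simp only at hl
      omega

theorem bad_eq_false {n k : ℕ} {cl : List (List (ℕ × Bool))} {T : Item} :
    bad n k cl T = false ↔
      (∀ t ∈ T, t.2.1 < t.2.2 ∧ (t.1 = 0 → t.2.1 = 0) ∧ (t.1 = k → t.2.2 = n + 1)) ∧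
      ∀ C ∈ cl, ∃ l ∈ C, ∀ t ∈ T, falsifies t l = false := by
  simp only [bad, Bool.or_eq_false_iff, List.any_eq_false, List.all_eq_true, Bool.or_eq_true,
    Bool.and_eq_true, decide_eq_true_eq, beq_iff_eq, Bool.not_eq_true', beq_eq_false_iff_ne,
    not_or, not_and, not_not, not_le, List.any_eq_true, not_forall, not_exists, Bool.not_eq_true,
    and_assoc, exists_prop]

theorem conf_eq_false_of_values {x : ℕ → ℕ} {T : Item} {j : ℕ}
    (hT : ∀ t ∈ T, t.2.1 = x t.1 ∧ t.2.2 = x (t.1 + 1)) : conf T [(j, x j, 0)] = false := by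
  simp only [conf, List.any_eq_false, List.mem_singleton, Bool.not_eq_true]
  rintro t ht - rfl
  have := hT t ht
  simp only [Bool.or_eq_false_iff, Bool.and_eq_false_iff, beq_eq_false_iff_ne,
    Bool.not_eq_false', beq_iff_eq, this.1, this.2]
  constructor
  · by_cases h : t.1 = j
    · exact .inr (by rw [h])
    · exact .inl h
  · by_cases h : t.1 + 1 = j
    · exact .inr (by rw [h])
    · exact .inl h

theorem values_of_conf_eq_false {T : Item} {j h : ℕ} (hc : conf T [(j, h, 0)] = false) :
    ∀ t ∈ T, (t.1 = j → t.2.1 = h) ∧ (t.1 + 1 = j → t.2.2 = h) := by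
  simpa [conf] using hc

/-- Every stretch selects the item that tells the truth about the values; a satisfied literal in
each clause is refuted by none of the intervals. -/
theorem selectable_of_satisfiableWith {d n k : ℕ} {cl : List (List (ℕ × Bool))}
    (hvar : ∀ C ∈ cl, ∀ l ∈ C, l.1 < n) (h : SatisfiableWith n k cl) :
    Selectable (cnfStretches d n k cl) := by
  obtain ⟨S, hcard, hS, hsat⟩ := h
  obtain ⟨x, hx⟩ := exists_values hcard hS
  refine ⟨fun sd T => if sd then ∃ j, T = [(j, x j, 0)] else
    ∀ t ∈ T, t.2.1 = x t.1 ∧ t.2.2 = x (t.1 + 1), fun X hX => ?_, fun T T' hT hT' => ?_⟩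
  · have hle : ∀ j ≤ k + 1, x j < n + 2 := fun j hj => by
      rcases hj.lt_or_eq with h | rfl
      · have := hx.mono h le_rfl
        have := hx.last
        omega
      · rw [hx.last]; omega
    rcases List.mem_append.1 hX with hX | hX
    · obtain ⟨Y, hY, rfl⟩ := List.mem_map.1 hX
      obtain ⟨I, -, hI, hmem⟩ := mem_tupleStretches hY
      have hT : ∀ t ∈ I.map fun j => (j, x j, x (j + 1)),
          t.1 ≤ k ∧ t = (t.1, x t.1, x (t.1 + 1)) := by
        intro t ht
        obtain ⟨j, hj, rfl⟩ := List.mem_map.1 ht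
        exact ⟨hI j hj, rfl⟩
      refine ⟨I.map fun j => (j, x j, x (j + 1)), List.mem_filter.2 ⟨(hmem _).2 ⟨?_, ?_⟩, ?_⟩, ?_⟩
      · simp [Function.comp_def]
      · intro t ht
        obtain ⟨h1, h2⟩ := hT t ht
        rw [h2]
        exact ⟨hle _ (by omega), hle _ (by omega)⟩
      · rw [Bool.not_eq_true', bad_eq_false]
        refine ⟨fun t ht => ?_, fun C hC => ?_⟩
        · obtain ⟨h1, h2⟩ := hT t ht
          rw [h2]
          refine ⟨hx.lt _ h1, fun h3 => ?_, fun h3 => ?_⟩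
          · simp only at h3 ⊢; rw [h3, hx.zero]
          · simp only at h3 ⊢; rw [h3, hx.last]
        · obtain ⟨l, hl, h1⟩ := hsat C hC
          refine ⟨l, hl, fun t ht => ?_⟩
          obtain ⟨h2, h3⟩ := hT t ht
          rw [h3]
          exact (hx.satisfies (hvar C hC l hl)).1 h1 _ h2
      · simp only [Bool.false_eq_true, if_false]
        intro t ht
        have := (hT t ht).2
        rw [this]
        exact ⟨rfl, rfl⟩
    · obtain ⟨Y, hY, rfl⟩ := List.mem_map.1 hX
      simp only [valueStretches, List.mem_map, List.mem_range] at hY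
      obtain ⟨j, hj, rfl⟩ := hY
      refine ⟨[(j, x j, 0)], List.mem_map.2 ⟨x j, List.mem_range.2 (hle j (by omega)), rfl⟩, ?_⟩
      simp
  · simp only [Bool.false_eq_true, if_false, if_true] at hT hT'
    obtain ⟨j, rfl⟩ := hT'
    exact conf_eq_false_of_values hT

theorem satisfiableWith_of_selectable {d n k : ℕ} {cl : List (List (ℕ × Bool))} (hd : 1 ≤ d)
    (hwidth : ∀ C ∈ cl, C.length ≤ d) (hvar : ∀ C ∈ cl, ∀ l ∈ C, l.1 < n)
    (h : Selectable (cnfStretches d n k cl)) : SatisfiableWith n k cl := by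
  obtain ⟨P, hsel, hP⟩ := h
  have hx : ∀ j, ∃ y, j ≤ k + 1 → P true [(j, y, 0)] := by
    intro j
    by_cases hj : j ≤ k + 1
    · obtain ⟨T, hT, h⟩ := hsel (true, (List.range (n + 2)).map fun h => [(j, h, 0)])
        (List.mem_append_right _ (List.mem_map_of_mem (List.mem_map.2
          ⟨j, List.mem_range.2 (by omega), rfl⟩)))
      obtain ⟨y, -, rfl⟩ := List.mem_map.1 hT
      exact ⟨y, fun _ => h⟩
    · exact ⟨0, fun h => absurd h hj⟩
  choose x hx using hx
  -- Freedom from conflicts with the values at `j` and `j + 1` determines the selected item of each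
  -- tuple, so the true intervals passed the filter.
  have htuple : ∀ I : List ℕ, I.length = d → (∀ j ∈ I, j ≤ k) →
      bad n k cl (I.map fun j => (j, x j, x (j + 1))) = false := by
    intro I hI hk
    obtain ⟨X, hX, hX'⟩ := exists_tupleStretch (n := n) hI hk
    obtain ⟨T, hT, h⟩ := hsel (false, X.filter fun T => !bad n k cl T)
      (List.mem_append_left _ (List.mem_map.2 ⟨X, hX, rfl⟩))
    simp only [List.mem_filter, Bool.not_eq_true'] at hT
    have hval : T = I.map fun j => (j, x j, x (j + 1)) := by
      rw [← hX' T hT.1, List.map_map]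
      refine (List.map_id T).symm.trans (List.map_congr_left fun t ht => ?_)
      have hle := hk t.1 (by rw [← hX' T hT.1]; exact List.mem_map_of_mem ht)
      have h1 := (values_of_conf_eq_false (hP _ _ h (hx t.1 (by omega))) t ht).1 rfl
      have h2 := (values_of_conf_eq_false (hP _ _ h (hx (t.1 + 1) (by omega))) t ht).2 rfl
      exact Prod.ext rfl (Prod.ext h1 h2)
    rw [← hval]
    exact hT.2
  have hsingle : ∀ j ≤ k, x j < x (j + 1) ∧ (j = 0 → x j = 0) ∧ (j = k → x (j + 1) = n + 1) := by
    intro j hj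
    -- The constant tuple tests a single interval; `1 ≤ d` ensures that `j` occurs in it.
    have h1 := htuple (List.replicate d j) (by simp) (fun i hi => by
      rw [List.eq_of_mem_replicate hi]; exact hj)
    exact (bad_eq_false.1 h1).1 (j, x j, x (j + 1)) (by simp; omega)
  have hpos : ∀ j, 1 ≤ j → j ≤ k → 1 ≤ x j := fun j h1 h2 => by
    have := (hsingle (j - 1) (by omega)).1
    rw [Nat.sub_add_cancel h1] at this
    omega
  have hvalues : Values n k ((Finset.Icc 1 k).image fun j => x j - 1) x := by
    refine ⟨(hsingle 0 (by omega)).2.1 rfl, (hsingle k le_rfl).2.2 rfl,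
      fun j hj => (hsingle j hj).1, fun v => ?_⟩
    simp only [Finset.mem_image, Finset.mem_Icc]
    refine exists_congr fun j => ⟨fun ⟨⟨h1, h2⟩, h3⟩ => ⟨h1, h2, ?_⟩,
      fun ⟨h1, h2, h3⟩ => ⟨⟨h1, h2⟩, by omega⟩⟩
    have := hpos j h1 h2
    omega
  refine ⟨(Finset.Icc 1 k).image fun j => x j - 1, ?_, fun v hv => ?_, fun C hC => ?_⟩
  · rw [Finset.card_image_of_injOn, Nat.card_Icc, Nat.add_sub_cancel]
    intro i hi j hj hij
    simp only [Finset.coe_Icc, Set.mem_Icc] at hi hj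
    have h1 := hpos i hi.1 hi.2
    have h2 := hpos j hj.1 hj.2
    simp only at hij
    rcases lt_trichotomy i j with h | h | h
    · have := hvalues.mono h (by omega); omega
    · exact h
    · have := hvalues.mono h (by omega); omega
  · obtain ⟨j, h1, h2, h3⟩ := (hvalues.mem v).1 hv
    have := hvalues.mono (show j < k + 1 by omega) le_rfl
    rw [hvalues.last] at this
    omega
  · by_contra hcon
    simp only [not_exists, not_and] at hcon
    have hJ : ∀ l, ∃ j, l ∈ C → j ≤ k ∧ falsifies (j, x j, x (j + 1)) l = true := by
      intro l
      by_cases hl : l ∈ C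
      · have := hcon l hl
        rw [hvalues.satisfies (hvar C hC l hl)] at this
        push Not at this
        obtain ⟨j, h1, h2⟩ := this
        exact ⟨j, fun _ => ⟨h1, by simpa using h2⟩⟩
      · exact ⟨0, fun h => absurd h hl⟩
    choose J hJ using hJ
    -- One refuting interval per literal of the violated clause, padded with the index 0 to length
    -- `d`: this item would be bad.
    have h1 := htuple (C.map J ++ List.replicate (d - C.length) 0)
      (by have := hwidth C hC; simp; omega) (by
        intro j hj
        rcases List.mem_append.1 hj with hj | hj
        · obtain ⟨l, hl, rfl⟩ := List.mem_map.1 hj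
          exact (hJ l hl).1
        · rw [List.eq_of_mem_replicate hj]; omega)
    obtain ⟨l, hl, h2⟩ := (bad_eq_false.1 h1).2 C hC
    have h3 := h2 (J l, x (J l), x (J l + 1))
      (List.mem_map.2 ⟨J l, List.mem_append_left _ (List.mem_map_of_mem hl), rfl⟩)
    rw [(hJ l hl).2] at h3
    exact absurd h3 (by simp)

end POH

namespace POH
open TreeEnc (tree)

/-! ### The reduction is computed in polynomial time -/

section
variable {α : Type} [TreeEnc α]

namespace VData

theorem pt_tuple {f : α → VData} (hf : PT f) :
    PT (fun a => ((f a).kind, (f a).st, (f a).lo, (f a).hi, (f a).a, (f a).b)) :=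
  (PT.of_tree_eq (f := fun v : VData => (v.kind, v.st, v.lo, v.hi, v.a, v.b)) fun _ => rfl).comp hf

@[fun_prop] theorem pt_kind {f : α → VData} (hf : PT f) : PT (fun a => (f a).kind) :=
  (pt_tuple hf).fst'
@[fun_prop] theorem pt_st {f : α → VData} (hf : PT f) : PT (fun a => (f a).st) :=
  (pt_tuple hf).snd'.fst'
@[fun_prop] theorem pt_lo {f : α → VData} (hf : PT f) : PT (fun a => (f a).lo) :=
  (pt_tuple hf).snd'.snd'.fst'
@[fun_prop] theorem pt_hi {f : α → VData} (hf : PT f) : PT (fun a => (f a).hi) :=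
  (pt_tuple hf).snd'.snd'.snd'.fst'
@[fun_prop] theorem pt_a {f : α → VData} (hf : PT f) : PT (fun a => (f a).a) :=
  (pt_tuple hf).snd'.snd'.snd'.snd'.fst'
@[fun_prop] theorem pt_b {f : α → VData} (hf : PT f) : PT (fun a => (f a).b) :=
  (pt_tuple hf).snd'.snd'.snd'.snd'.snd'

@[fun_prop] theorem pt_mk {k s l h : α → ℕ} {A B : α → Item} (hk : PT k) (hs : PT s) (hl : PT l)
    (hh : PT h) (hA : PT A) (hB : PT B) :
    PT (fun a => VData.mk (k a) (s a) (l a) (h a) (A a) (B a)) :=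
  (PT.of_tree_eq (f := fun p : ℕ × ℕ × ℕ × ℕ × Item × Item =>
    VData.mk p.1 p.2.1 p.2.2.1 p.2.2.2.1 p.2.2.2.2.1 p.2.2.2.2.2) fun _ => rfl).comp
    (hk.pair (hs.pair (hl.pair (hh.pair (hA.pair hB)))))

end VData

@[fun_prop] theorem PT.conf {f g : α → Item} (hf : PT f) (hg : PT g) :
    PT (fun a => POH.conf (f a) (g a)) := by
  unfold POH.conf; fun_prop

@[fun_prop] theorem PT.adjHalf {link : Bool} {f g : α → VData × ℕ} (hf : PT f) (hg : PT g) :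
    PT (fun a => POH.adjHalf link (f a) (g a)) := by
  unfold POH.adjHalf; fun_prop

@[fun_prop] theorem PT.adjB {link : Bool} {f g : α → VData × ℕ} (hf : PT f) (hg : PT g) :
    PT (fun a => POH.adjB link (f a) (g a)) := by
  unfold POH.adjB; fun_prop

@[fun_prop] theorem PT.precB {f g : α → VData × ℕ} (hf : PT f) (hg : PT g) :
    PT (fun a => POH.precB (f a) (g a)) := by
  unfold POH.precB; fun_prop

@[fun_prop] theorem PT.endV {f : α → Bool} {g : α → ℕ} (hf : PT f) (hg : PT g) :
    PT (fun a => POH.endV (f a) (g a)) := by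
  unfold POH.endV; fun_prop

@[fun_prop] theorem PT.itemV {f : α → Bool} {g : α → ℕ} {h : α → Item} (hf : PT f) (hg : PT g)
    (hh : PT h) : PT (fun a => POH.itemV (f a) (g a) (h a)) := by
  unfold POH.itemV; fun_prop

@[fun_prop] theorem PT.stretches {f : α → List (Bool × List Item)} (hf : PT f) :
    PT (fun a => POH.stretches (f a)) := by
  unfold POH.stretches; fun_prop

@[fun_prop] theorem PT.chunk {f : α → (Bool × List Item) × ℕ} (hf : PT f) :
    PT (fun a => POH.chunk (f a)) := by
  unfold POH.chunk; fun_prop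

@[fun_prop] theorem PT.pathData {f : α → List (Bool × List Item)} (hf : PT f) :
    PT (fun a => POH.pathData (f a)) := by
  unfold POH.pathData; fun_prop

@[fun_prop] theorem PT.beq_bool {f g : α → Bool} (hf : PT f) (hg : PT g) :
    PT (fun a => f a == g a) :=
  (hf.ite hg hg.not).congr fun a => by cases f a <;> cases g a <;> rfl

@[fun_prop] theorem PT.slots {f : α → List (Bool × List Item)} (hf : PT f) :
    PT (fun a => POH.slots (f a)) := by
  unfold POH.slots; fun_prop

@[fun_prop] theorem PT.slotData {f : α → List (Bool × List Item)} (hf : PT f) :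
    PT (fun a => POH.slotData (f a)) := by
  unfold POH.slotData POH.inV POH.outV; fun_prop

@[fun_prop] theorem PT.gadget {f : α → List (Bool × List Item)} (hf : PT f) :
    PT (fun a => POH.gadget (f a)) := by
  unfold POH.gadget; fun_prop

@[fun_prop] theorem PT.falsifies {f : α → ℕ × ℕ × ℕ} {g : α → ℕ × Bool} (hf : PT f) (hg : PT g) :
    PT (fun a => POH.falsifies (f a) (g a)) := by
  unfold POH.falsifies; fun_prop

@[fun_prop] theorem PT.bad {n k : α → ℕ} {cl : α → List (List (ℕ × Bool))} {T : α → Item}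
    (hn : PT n) (hk : PT k) (hcl : PT cl) (hT : PT T) :
    PT (fun a => POH.bad (n a) (k a) (cl a) (T a)) := by
  unfold POH.bad; fun_prop

-- The width `d` is a constant outside of the input; each of its finitely many levels is polynomial
-- in the previous one.
@[fun_prop] theorem PT.tupleStretches {n k : α → ℕ} (hn : PT n) (hk : PT k) (d : ℕ) :
    PT (fun a => POH.tupleStretches (n a) (k a) d) := by
  have key : PT (fun p : ℕ × ℕ => POH.tupleStretches p.1 p.2 d) := by
    induction d with
    | zero => exact PT.const _
    | succ d ih =>
      unfold POH.tupleStretches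
      exact PT.flatMap (by fun_prop) (PT.map
        (ih.comp (f := fun q : (ℕ × ℕ) × ℕ => q.1) (by fun_prop)) (by fun_prop))
  exact key.comp (hn.pair hk)

@[fun_prop] theorem PT.cnfStretches (d : ℕ) {n k : α → ℕ} {cl : α → List (List (ℕ × Bool))}
    (hn : PT n) (hk : PT k) (hcl : PT cl) :
    PT (fun a => POH.cnfStretches d (n a) (k a) (cl a)) := by
  unfold POH.cnfStretches POH.valueStretches; fun_prop

end

/-- The encoding of the ordered graph that is given by `data`. -/
def graphWord (link : Bool) (data : List VData) : List Bool :=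
  encNat data.zipIdx.length ++ ((data.zipIdx.flatMap fun x => data.zipIdx.map fun y => adjB link x y) ++
    data.zipIdx.flatMap fun x => data.zipIdx.map fun y => precB x y)

theorem graphWord_eq_enc (link : Bool) {data : List VData} (h : Valid data) :
    graphWord link data = (orderedGraph link data h).enc := by
  have key : ∀ b : VData × ℕ → VData × ℕ → Bool,
      (data.zipIdx.flatMap fun x => data.zipIdx.map fun y => b x y) =
        encRel (fun i j => b (vtx data i) (vtx data j) = true) := fun b => by
    simp only [encRel, ← map_vtx_finRange, List.flatMap_map, List.map_map, Bool.decide_eq_true]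
    rfl
  rw [graphWord, key, key, List.length_zipIdx]
  rfl

/-! ### Parsing of encoded formulas -/

/-- The state of the parser for formulas. -/
structure ParseState where
  mode : ℕ
  n : ℕ
  k : ℕ
  clauses : List (List (ℕ × Bool))
  clause : List (ℕ × Bool)
  sign : Bool
  count : ℕ

instance : TreeEnc ParseState :=
  ⟨fun s => tree (s.mode, s.n, s.k, s.clauses, s.clause, s.sign, s.count)⟩

namespace ParseState

section
variable {α : Type} [TreeEnc α]

theorem pt_tuple {f : α → ParseState} (hf : PT f) : PT (fun a => ((f a).mode, (f a).n, (f a).k,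
    (f a).clauses, (f a).clause, (f a).sign, (f a).count)) :=
  (PT.of_tree_eq (f := fun s : ParseState => (s.mode, s.n, s.k, s.clauses, s.clause, s.sign,
    s.count)) fun _ => rfl).comp hf

@[fun_prop] theorem pt_mode {f : α → ParseState} (hf : PT f) : PT (fun a => (f a).mode) :=
  (pt_tuple hf).fst'
@[fun_prop] theorem pt_n {f : α → ParseState} (hf : PT f) : PT (fun a => (f a).n) :=
  (pt_tuple hf).snd'.fst'
@[fun_prop] theorem pt_k {f : α → ParseState} (hf : PT f) : PT (fun a => (f a).k) :=
  (pt_tuple hf).snd'.snd'.fst'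
@[fun_prop] theorem pt_clauses {f : α → ParseState} (hf : PT f) : PT (fun a => (f a).clauses) :=
  (pt_tuple hf).snd'.snd'.snd'.fst'
@[fun_prop] theorem pt_clause {f : α → ParseState} (hf : PT f) : PT (fun a => (f a).clause) :=
  (pt_tuple hf).snd'.snd'.snd'.snd'.fst'
@[fun_prop] theorem pt_sign {f : α → ParseState} (hf : PT f) : PT (fun a => (f a).sign) :=
  (pt_tuple hf).snd'.snd'.snd'.snd'.snd'.fst'
@[fun_prop] theorem pt_count {f : α → ParseState} (hf : PT f) : PT (fun a => (f a).count) :=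
  (pt_tuple hf).snd'.snd'.snd'.snd'.snd'.snd'

@[fun_prop] theorem pt_mk {m n k c : α → ℕ} {cl : α → List (List (ℕ × Bool))}
    {cu : α → List (ℕ × Bool)} {s : α → Bool} (hm : PT m) (hn : PT n) (hk : PT k) (hcl : PT cl)
    (hcu : PT cu) (hs : PT s) (hc : PT c) :
    PT (fun a => ParseState.mk (m a) (n a) (k a) (cl a) (cu a) (s a) (c a)) :=
  (PT.of_tree_eq (f := fun p : ℕ × ℕ × ℕ × List (List (ℕ × Bool)) × List (ℕ × Bool) × Bool × ℕ =>
    ParseState.mk p.1 p.2.1 p.2.2.1 p.2.2.2.1 p.2.2.2.2.1 p.2.2.2.2.2.1 p.2.2.2.2.2.2)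
    fun _ => rfl).comp
    (hm.pair (hn.pair (hk.pair (hcl.pair (hcu.pair (hs.pair hc))))))

end

/-- Modes: `0` number of variables, `1` weight, `2` list of clauses, `3` list of literals, `4` sign,
`5` variable. -/
def step (s : ParseState) (b : Bool) : ParseState :=
  if (s.mode == 0) = true then
    if b = true then ⟨0, s.n + 1, s.k, s.clauses, s.clause, s.sign, s.count⟩
    else ⟨1, s.n, s.k, s.clauses, s.clause, s.sign, s.count⟩
  else if (s.mode == 1) = true then
    if b = true then ⟨1, s.n, s.k + 1, s.clauses, s.clause, s.sign, s.count⟩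
    else ⟨2, s.n, s.k, s.clauses, s.clause, s.sign, s.count⟩
  else if (s.mode == 2) = true then
    if b = true then ⟨3, s.n, s.k, s.clauses, s.clause, s.sign, s.count⟩
    else ⟨6, s.n, s.k, s.clauses, s.clause, s.sign, s.count⟩
  else if (s.mode == 3) = true then
    if b = true then ⟨4, s.n, s.k, s.clauses, s.clause, s.sign, s.count⟩
    else ⟨2, s.n, s.k, s.clause :: s.clauses, [], s.sign, s.count⟩
  else if (s.mode == 4) = true then ⟨5, s.n, s.k, s.clauses, s.clause, b, s.count⟩
  else if (s.mode == 5) = true then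
    if b = true then ⟨5, s.n, s.k, s.clauses, s.clause, s.sign, s.count + 1⟩
    -- Sign and counter are reset, so that every literal starts from the same state, as
    -- `foldl_clause` requires.
    else ⟨3, s.n, s.k, s.clauses, (s.count, s.sign) :: s.clause, false, 0⟩
  else s

def parse (w : List Bool) : ParseState := w.foldl step ⟨0, 0, 0, [], [], false, 0⟩

theorem sz_mk (m n k c : ℕ) (cl : List (List (ℕ × Bool))) (cu : List (ℕ × Bool)) (s : Bool) :
    sz (ParseState.mk m n k cl cu s c) = sz m + (sz n + (sz k + (sz cl + (sz cu +
      (sz s + sz c + 1) + 1) + 1) + 1) + 1) + 1 := rfl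

/-- Closing a literal or a clause only moves stored data, so the growth is constant, as
`foldl_growth` needs; 20 is a generous bound. -/
theorem sz_step_le (s : ParseState) (b : Bool) : sz (step s b) ≤ sz s + 20 := by
  obtain ⟨m, n, k, cl, cu, sg, c⟩ := s
  have h1 := sz_bool_le b
  have h2 := sz_bool_le sg
  have h3 := one_le_sz sg
  have h4 := sz_bool_le false
  unfold step
  split_ifs <;> simp only [sz_mk, sz_nat, sz_cons, sz_pair, sz_nil] <;> omega

theorem pt_parse : PT parse :=
  (PT.foldl_growth (l := fun w : List Bool => w) (init := fun _ => ⟨0, 0, 0, [], [], false, 0⟩)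
    (F := fun _ => step) (G := fun _ => 20) PT.id (PT.const _)
    (by unfold step; fun_prop) (.const 20) fun _ s b => sz_step_le s b).congr fun _ => rfl

theorem foldl_n (m n k : ℕ) (cl : List (List (ℕ × Bool))) (cu : List (ℕ × Bool)) (sg : Bool)
    (c : ℕ) (t : List Bool) : (encNat m ++ t).foldl step ⟨0, n, k, cl, cu, sg, c⟩ =
      t.foldl step ⟨1, n + m, k, cl, cu, sg, c⟩ := by
  induction m generalizing n with
  | zero => rfl
  | succ m ih => exact (ih (n + 1)).trans (by rw [add_assoc, add_comm 1 m])

theorem foldl_k (m n k : ℕ) (cl : List (List (ℕ × Bool))) (cu : List (ℕ × Bool)) (sg : Bool)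
    (c : ℕ) (t : List Bool) : (encNat m ++ t).foldl step ⟨1, n, k, cl, cu, sg, c⟩ =
      t.foldl step ⟨2, n, k + m, cl, cu, sg, c⟩ := by
  induction m generalizing k with
  | zero => rfl
  | succ m ih => exact (ih (k + 1)).trans (by rw [add_assoc, add_comm 1 m])

theorem foldl_var (m n k : ℕ) (cl : List (List (ℕ × Bool))) (cu : List (ℕ × Bool)) (sg : Bool)
    (c : ℕ) (t : List Bool) : (encNat m ++ t).foldl step ⟨5, n, k, cl, cu, sg, c⟩ =
      t.foldl step ⟨3, n, k, cl, (c + m, sg) :: cu, false, 0⟩ := by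
  induction m generalizing c with
  | zero => rfl
  | succ m ih => exact (ih (c + 1)).trans (by rw [add_assoc, add_comm 1 m])

/-- A literal, with a number instead of an element of `Fin n`. -/
def lit {n : ℕ} (l : Fin n × Bool) : ℕ × Bool := (l.1, l.2)

theorem foldl_clause {N : ℕ} (C : List (Fin N × Bool)) (n k : ℕ) (cl : List (List (ℕ × Bool)))
    (cu : List (ℕ × Bool)) (t : List Bool) :
    (encList CNFInst.encLit C ++ t).foldl step ⟨3, n, k, cl, cu, false, 0⟩ =
      t.foldl step ⟨2, n, k, ((C.map lit).reverse ++ cu) :: cl, [], false, 0⟩ := by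
  induction C generalizing cu with
  | nil => rfl
  | cons l C ih =>
    have h := foldl_var l.1 n k cl cu l.2 0 (encList CNFInst.encLit C ++ t)
    rw [ih, Nat.zero_add] at h
    simp only [List.map_cons, List.reverse_cons, List.append_assoc, List.cons_append,
      List.nil_append]
    rw [← show lit l = ((l.1 : ℕ), l.2) from rfl] at h
    rw [← h]
    simp only [encList, CNFInst.encLit, List.cons_append, List.append_assoc, List.foldl_cons]
    rfl

theorem foldl_clauses {N : ℕ} (L : List (List (Fin N × Bool))) (n k : ℕ)
    (cl : List (List (ℕ × Bool))) :
    (encList (encList CNFInst.encLit) L).foldl step ⟨2, n, k, cl, [], false, 0⟩ =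
      ⟨6, n, k, (L.map fun C => (C.map lit).reverse).reverse ++ cl, [], false, 0⟩ := by
  induction L generalizing cl with
  | nil => rfl
  | cons C L ih =>
    have h := foldl_clause C n k cl [] (encList (encList CNFInst.encLit) L)
    rw [ih, List.append_nil] at h
    rw [List.map_cons, List.reverse_cons, List.append_assoc]
    exact h

theorem parse_enc {d : ℕ} (φ : CNFInst d) : parse φ.enc =
    ⟨6, φ.n, φ.k, (φ.clauses.map fun C => (C.map lit).reverse).reverse, [], false, 0⟩ := by
  rw [parse, CNFInst.enc, foldl_n, foldl_k, foldl_clauses]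
  simp

end ParseState

/-! ### Correctness of the reduction -/

/-- The parser reverses all lists; this is harmless, since satisfaction depends only on membership.
-/
theorem CNFInst.yes_iff {d : ℕ} (φ : CNFInst d) : φ.Yes ↔
    SatisfiableWith φ.n φ.k (φ.clauses.map fun C => (C.map ParseState.lit).reverse).reverse := by
  simp only [CNFInst.Yes, SatisfiableWith, List.mem_reverse, List.mem_map, forall_exists_index,
    and_imp, forall_apply_eq_imp_iff₂, exists_exists_and_eq_and, ParseState.lit]
  constructor
  · rintro ⟨S, h1, h2⟩
    refine ⟨S.map Fin.valEmbedding, by rw [Finset.card_map, h1], fun v hv => ?_, fun C hC => ?_⟩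
    · obtain ⟨i, -, rfl⟩ := Finset.mem_map.1 hv
      exact i.2
    · obtain ⟨l, hl, h3⟩ := h2 C hC
      refine ⟨l, hl, ?_⟩
      rw [← h3]
      exact Finset.mem_map' Fin.valEmbedding
  · rintro ⟨S, h1, h2, h3⟩
    have hS : (S.attachFin h2).map Fin.valEmbedding = S := Finset.map_valEmbedding_attachFin h2
    refine ⟨S.attachFin h2, by rw [Finset.card_attachFin, h1], fun C hC => ?_⟩
    obtain ⟨l, hl, h4⟩ := h3 C hC
    exact ⟨l, hl, by rwa [Finset.mem_attachFin]⟩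

/-- The formula as a selection problem. -/
def CNFInst.stretches {d : ℕ} (φ : CNFInst d) : List (Bool × List Item) :=
  cnfStretches d φ.n φ.k (φ.clauses.map fun C => (C.map ParseState.lit).reverse).reverse

theorem CNFInst.selectable_iff {d : ℕ} (hd : 1 ≤ d) (φ : CNFInst d) :
    Selectable φ.stretches ↔ φ.Yes := by
  have hvar : ∀ C ∈ (φ.clauses.map fun C => (C.map ParseState.lit).reverse).reverse,
      ∀ l ∈ C, l.1 < φ.n := by
    simp only [List.mem_reverse, List.mem_map, forall_exists_index, and_imp,
      forall_apply_eq_imp_iff₂]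
    exact fun C _ l _ => l.1.2
  rw [φ.yes_iff]
  refine ⟨satisfiableWith_of_selectable hd ?_ hvar, selectable_of_satisfiableWith hvar⟩
  simp only [List.mem_reverse, List.mem_map, forall_exists_index, and_imp,
    forall_apply_eq_imp_iff₂, List.length_reverse, List.length_map]
  exact φ.width

/-- The reduction. -/
def CNFInst.orderedGraph (link : Bool) {d : ℕ} (φ : CNFInst d) : OrderedGraph :=
  POH.orderedGraph link (gadget φ.stretches) valid_gadget

theorem CNFInst.exists_pt_orderedGraph (link : Bool) (d : ℕ) : ∃ F : List Bool → List Bool,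
    PT F ∧ ∀ φ : CNFInst d, F φ.enc = (φ.orderedGraph link).enc := by
  refine ⟨fun w => graphWord link (gadget (cnfStretches d (ParseState.parse w).n
    (ParseState.parse w).k (ParseState.parse w).clauses)), ?_, fun φ => ?_⟩
  · have := ParseState.pt_parse
    unfold graphWord
    fun_prop
  · dsimp only
    rw [ParseState.parse_enc]
    exact graphWord_eq_enc link valid_gadget

theorem CNFInst.length_stretches {d : ℕ} (φ : CNFInst d) :
    φ.stretches.length = (φ.k + 1) ^ d + (φ.k + 2) := length_cnfStretches _ _ _ _

theorem w1Hard_of_gadget {P : ParamProblem} (link : Bool) (R : OrderedGraph → P.Inst)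
    (henc : ∀ I, P.enc (R I) = I.enc)
    (hyes : ∀ S : List (Bool × List Item),
      P.yes (R (orderedGraph link (gadget S) valid_gadget)) ↔ Selectable S)
    (hparam : ∀ S : List (Bool × List Item), S ≠ [] →
      P.param (R (orderedGraph link (gadget S) valid_gadget)) ≤ 2 + 12 * S.length) :
    W1Hard P := by
  refine w1Hard_of_polyTime fun d hd => ?_
  obtain ⟨F, hF, hF'⟩ := CNFInst.exists_pt_orderedGraph link d
  refine ⟨fun φ => R (φ.orderedGraph link), F, fun k => 2 + 12 * ((k + 1) ^ d + (k + 2)), hF,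
    fun φ => (hF' φ).trans (henc _).symm, fun φ => ?_, ?_, fun a b hab => ?_, fun φ => ?_⟩
  · exact (φ.selectable_iff hd).symm.trans (hyes _).symm
  · have h1 : Primrec fun k : ℕ => (k + 1) ^ d := (primrec_pow d).comp Primrec.succ
    exact (Primrec.nat_add.comp (Primrec.const 2) (Primrec.nat_mul.comp (Primrec.const 12)
      (Primrec.nat_add.comp h1 (Primrec.nat_add.comp Primrec.id (Primrec.const 2))))).to_comp
  · have := Nat.pow_le_pow_left (show a + 1 ≤ b + 1 by omega) d
    simp only
    omega
  · simp only
    rw [← φ.length_stretches]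
    refine hparam _ fun h => ?_
    have := φ.length_stretches
    rw [h, List.length_nil] at this
    omega

end POH

theorem theorem3p1 :
    POH.W1Hard (POH.POHPP POH.distToPath) ∧
    POH.W1Hard (POH.POHCP POH.distToPath) ∧
    POH.W1Hard (POH.POHPP POH.distToLinearForestModules) ∧
    POH.W1Hard (POH.POHCP POH.distToLinearForestModules) :=
  ⟨POH.w1Hard_of_gadget true id (fun _ => rfl) (fun _ => POH.hasHamPath_iff_selectable)
      fun _ => POH.distToPath_gadget_le,
    POH.w1Hard_of_gadget true id (fun _ => rfl) (fun _ => POH.hasHamCycle_iff_selectable)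
      fun _ => POH.distToPath_gadget_le,
    POH.w1Hard_of_gadget false id (fun _ => rfl) (fun _ => POH.hasHamPath_iff_selectable)
      fun _ _ => POH.distToLinearForestModules_gadget_le,
    POH.w1Hard_of_gadget false id (fun _ => rfl) (fun _ => POH.hasHamCycle_iff_selectable)
      fun _ _ => POH.distToLinearForestModules_gadget_le⟩
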